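/- For a group $G$ let $S(G)$ be the group of all permutations of the set $G$, let $\rho(G)\le S(G)$ be the image of the right regular representation (the set of all maps $x\mapsto xy$, $y\in G$), and put $\mathrm{Hol}(G)=N_{S(G)}(\rho(G))$, $\mathrm{NHol}(G)=N_{S(G)}(\mathrm{Hol}(G))$ and $T(G)=\mathrm{NHol}(G)/\mathrm{Hol}(G)$. Let $p$ be any odd prime and let $n\geq 4$ be any integer. There exists a finite $p$-group $G$ of nilpotency class two and of order $p^{n+\binom{n}{2}}$ such that $T(G)$ is an (internal) semidirect product of a normal elementary abelian $p$-subgroup of order $$p^{\binom{n}{2}\binom{n+1}{2}}$$ by a subgroup which is isomorphic to $$\mathbb{F}_p^{\left(\binom{n}{2}-n\right)\times n}\rtimes\left(\mathrm{GL}_n(\mathbb{F}_p)\times \mathrm{GL}_{\binom{n}{2}-n}(\mathbb{F}_p)\right),$$ where $\mathbb{F}_p^{m\times n}$ is the additive group of $m\times n$ matrices over $\mathbb{F}_p$, and where the semidirect product displayed here is given by the (right) action $$Q^{(A,M)}=M^{-1}QA$$ for any $Q\in\mathbb{F}_p^{(\binom{n}{2}-n)\times n}$, $A\in\mathrm{GL}_n(\mathbb{F}_p)$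 and $M\in\mathrm{GL}_{\binom{n}{2}-n}(\mathbb{F}_p)$. -/

import Mathlib

/-- The image of the right regular representation `y ↦ (x ↦ x * y)`, as a subgroup of the group of
all permutations of the set `G`. -/
def rightRegular (G : Type*) [Group G] : Subgroup (Equiv.Perm G) where
  carrier := Set.range fun y : G => Equiv.mulRight y
  one_mem' := ⟨1, by ext x; simp⟩
  mul_mem' := by
    rintro _ _ ⟨a, rfl⟩ ⟨b, rfl⟩
    exact ⟨b * a, by ext x; simp [mul_assoc]⟩
  inv_mem' := by
    rintro _ ⟨a, rfl⟩
    exact ⟨a⁻¹, by ext x; simp⟩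

/-- The holomorph of `G`: the normalizer of the right regular representation. -/
def Hol (G : Type*) [Group G] : Subgroup (Equiv.Perm G) :=
  Subgroup.normalizer (rightRegular G)

/-- The multiple holomorph of `G`: the normalizer of the holomorph. -/
def NHol (G : Type*) [Group G] : Subgroup (Equiv.Perm G) :=
  Subgroup.normalizer (Hol G)

instance Hol.normal_subgroupOf_NHol (G : Type*) [Group G] :
    ((Hol G).subgroupOf (NHol G)).Normal :=
  Subgroup.normal_in_normalizer

/-- The quotient group `T(G) = NHol(G) / Hol(G)`. -/
abbrev MultHolQuot (G : Type*) [Group G] : Type _ :=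
  NHol G ⧸ (Hol G).subgroupOf (NHol G)

/-- `G` is nilpotent of class exactly `2`. -/
def IsOfClassTwo (G : Type*) [Group G] : Prop :=
  ∃ _ : Group.IsNilpotent G, Group.nilpotencyClass G = 2

/-- `H` is an elementary abelian `p`-group: commutative, with every element killed by `p`. -/
def IsElementaryAbelian (p : ℕ) (H : Type*) [Group H] : Prop :=
  (∀ x y : H, x * y = y * x) ∧ ∀ x : H, x ^ p = 1

/-- The left action `(A, M) • Q = M * Q * A⁻¹` of `GL_n(R) × GL_m(R)` on the additive group of
`m × n` matrices (written multiplicatively).  In `N ⋊[φ] H` one has `φ h x = h * x * h⁻¹`, so the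
right action `Q ^ h = h⁻¹ * Q * h` in the resulting semidirect product is
`Q ^ (A, M) = M⁻¹ * Q * A`; see `inr_inv_mul_inl_mul_inr`. -/
def matrixAction (m n : ℕ) (R : Type*) [CommRing R] :
    GL (Fin n) R × GL (Fin m) R →* MulAut (Multiplicative (Matrix (Fin m) (Fin n) R)) where
  toFun g := AddEquiv.toMultiplicative
    { toFun := fun Q => (g.2 : Matrix (Fin m) (Fin m) R) * Q *
        ((g.1⁻¹ : GL (Fin n) R) : Matrix (Fin n) (Fin n) R)
      invFun := fun Q => ((g.2⁻¹ : GL (Fin m) R) : Matrix (Fin m) (Fin m) R) * Q *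
        (g.1 : Matrix (Fin n) (Fin n) R)
      left_inv := fun Q => by
        simp only [Matrix.mul_assoc, Units.inv_mul, Matrix.mul_one]
        rw [← Matrix.mul_assoc, Units.inv_mul, Matrix.one_mul]
      right_inv := fun Q => by
        simp only [Matrix.mul_assoc, Units.mul_inv, Matrix.mul_one]
        rw [← Matrix.mul_assoc, Units.mul_inv, Matrix.one_mul]
      map_add' := fun P Q => by rw [Matrix.mul_add, Matrix.add_mul] }
  map_one' := by
    ext Q : 1
    apply Multiplicative.toAdd.injective
    simp
  map_mul' g h := by
    ext Q : 1
    apply Multiplicative.toAdd.injective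
    simp [Matrix.mul_assoc]

/-- The semidirect product `R^(m × n) ⋊ (GL_n(R) × GL_m(R))` with `Q ^ (A, M) = M⁻¹ * Q * A`. -/
abbrev MatrixSemidirect (m n : ℕ) (R : Type*) [CommRing R] : Type _ :=
  Multiplicative (Matrix (Fin m) (Fin n) R) ⋊[matrixAction m n R] (GL (Fin n) R × GL (Fin m) R)

/-- Conjugation in the semidirect product is `Q ^ (A, M) = M⁻¹ * Q * A`. -/
theorem inr_inv_mul_inl_mul_inr (m n : ℕ) (R : Type*) [CommRing R]
    (Q : Matrix (Fin m) (Fin n) R) (A : GL (Fin n) R) (M : GL (Fin m) R) :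
    ((SemidirectProduct.inr (A, M))⁻¹ * SemidirectProduct.inl (Multiplicative.ofAdd Q) *
      SemidirectProduct.inr (A, M) : MatrixSemidirect m n R) =
    SemidirectProduct.inl (Multiplicative.ofAdd
      (((M⁻¹ : GL (Fin m) R) : Matrix (Fin m) (Fin m) R) * Q *
        (A : Matrix (Fin n) (Fin n) R))) := by
  rw [← map_inv, ← SemidirectProduct.inl_aut_inv]
  rfl

/-! Put `m = n.choose 2 - n`. On `B = (ℤ/p²)^n × (ℤ/p)^m` let `π` be reduction onto `𝔽_p^n`; its
kernel is the `p`-torsion, of rank `n + m = n.choose 2`, and is identified by `ι` with `Λ²(𝔽_p^n)`.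
The group is `B` with `x * y = x + y + ι (π x ∧ π y)`. Powers are multiples and commutators are `2 ι
(π x ∧ π y)`, so for odd `p` every automorphism is also additive (`mulEquiv_add`). It induces a
matrix `A` on `𝔽_p^n`, and `p`-th powers identify `𝔽_p^n` with the span of the `n` "edge"
coordinates of `Λ²`. Compatibility with commutators and powers then says that the rows of `A`
satisfy the multiplication table of an anticommutative algebra. That algebra is chosen to be rigid
(`eq_single_of_edgeBracket`), which forces `A = 1`.

Hence `Hol` is as small as possible: it consists of the maps `b ↦ b + φ b + t` with `φ ∈ Hom(B / ker
π, ker π)` (`mem_Hol_iff`). Being described by the additive structure alone, it has a large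
normalizer, namely the maps `b ↦ α b + q b + t` with `α` an additive automorphism and `q` quadratic
from `B / ker π` to `ker π` (`exists_of_mem_NHol`).

Modulo `Hol` the translation disappears and `α` counts only through its restriction to `ker π`. The
quadratic maps give the normal elementary abelian subgroup. The restrictions are exactly the
invertible block triangular matrices, since `pB` must be preserved; their contragredients form the
matrix semidirect product. -/

/-! ### A rigid anticommutative algebra -/

/-- The index pairs of the products `[x_{i-1}, x_i] = x_i` for `0 < i` and
`[x_{n-3}, x_{n-1}] = x_0` of an anticommutative algebra with basis `x_0, …, x_{n-1}`. -/
def edge (n : ℕ) (i : Fin n) : Fin n × Fin n :=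
  if h : (i : ℕ) = 0 then (⟨n - 3, by omega⟩, ⟨n - 1, by omega⟩)
  else (⟨i - 1, by omega⟩, i)

theorem edge_lt {n : ℕ} (hn : 4 ≤ n) (i : Fin n) : (edge n i).1 < (edge n i).2 := by
  unfold edge
  split_ifs with h
  · exact Fin.mk_lt_mk.2 (by omega)
  · exact Fin.lt_def.2 (by simp only; omega)

theorem edge_injective {n : ℕ} (hn : 4 ≤ n) : Function.Injective (edge n) := by
  intro i j hij
  unfold edge at hij
  split_ifs at hij with h1 h2 h2
  · exact Fin.ext (h1.trans h2.symm)
  · simp only [Prod.mk.injEq, Fin.ext_iff] at hij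
    omega
  · simp only [Prod.mk.injEq, Fin.ext_iff] at hij
    omega
  · exact (Prod.mk.inj hij).2

/-- The product of the anticommutative algebra with structure constants given by `edge`. -/
def edgeBracket {n : ℕ} {F : Type*} [CommRing F] (u v : Fin n → F) (i : Fin n) : F :=
  u (edge n i).1 * v (edge n i).2 - u (edge n i).2 * v (edge n i).1

theorem edgeBracket_zero {n : ℕ} {F : Type*} [CommRing F] (u v : Fin n → F) (h : 0 < n) :
    edgeBracket u v ⟨0, h⟩ = u ⟨n - 3, by omega⟩ * v ⟨n - 1, by omega⟩ -
      u ⟨n - 1, by omega⟩ * v ⟨n - 3, by omega⟩ := by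
  simp [edgeBracket, edge]

theorem edgeBracket_succ {n : ℕ} {F : Type*} [CommRing F] (u v : Fin n → F) (i : ℕ)
    (h : i + 1 < n) :
    edgeBracket u v ⟨i + 1, h⟩ =
      u ⟨i, by omega⟩ * v ⟨i + 1, h⟩ - u ⟨i + 1, h⟩ * v ⟨i, by omega⟩ := by
  simp [edgeBracket, edge]

theorem edgeBracket_sum_smul {n : ℕ} {F : Type*} [CommRing F] (u : Fin n → F)
    (r : Fin n → Fin n → F) (a : Fin n → F) :
    edgeBracket u (∑ k, a k • r k) = ∑ k, a k • edgeBracket u (r k) := by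
  ext i
  simp only [edgeBracket, Finset.sum_apply, Pi.smul_apply, smul_eq_mul, Finset.mul_sum,
    ← Finset.sum_sub_distrib]
  exact Finset.sum_congr rfl fun k _ => by ring

section Rigidity

variable {n : ℕ} {F : Type*} [Field F]

/-- A vector whose left multiplication has rank at most one is a multiple of the first basis
vector. -/
theorem eq_zero_of_edgeBracket_rank_le_one (hn : 4 ≤ n) {v w : Fin n → F}
    (h : ∀ u, ∃ a : F, edgeBracket v u = a • w) (k : Fin n) (hk : 0 < (k : ℕ)) : v k = 0 := by
  -- Rank at most one means that all 2 × 2 minors vanish; the test vectors below make one minor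
  -- equal to `± v k ^ 2`.
  have minor : ∀ (u u' : Fin n → F) (i j : Fin n),
      edgeBracket v u i * edgeBracket v u' j = edgeBracket v u j * edgeBracket v u' i := by
    intro u u' i j
    obtain ⟨a, ha⟩ := h u
    obtain ⟨b, hb⟩ := h u'
    simp only [ha, hb, Pi.smul_apply, smul_eq_mul]
    ring
  obtain ⟨k, hkn⟩ := k
  obtain ⟨l, rfl⟩ : ∃ l, k = l + 1 := ⟨k - 1, by simp only at hk; omega⟩
  by_cases hlast : l + 1 + 1 < n
  · have := minor (Pi.single ⟨l + 1 + 1, hlast⟩ 1) (Pi.single ⟨l, by omega⟩ 1) ⟨l + 1, hkn⟩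
      ⟨l + 1 + 1, hlast⟩
    simp only [edgeBracket_succ, Pi.single_apply, Fin.mk.injEq] at this
    have e1 : ¬ (l + 1 + 1 = l) := by omega
    simpa [e1] using this
  · have h1 := minor (Pi.single ⟨n - 2, by omega⟩ 1) (Pi.single ⟨n - 3, by omega⟩ 1)
      ⟨0, by omega⟩ ⟨l + 1, hkn⟩
    obtain rfl : n = l + 2 := by omega
    simp only [edgeBracket_succ, edgeBracket_zero, Pi.single_apply, Fin.mk.injEq] at h1
    have e1 : ¬ (l + 1 = l - 1) := by omega
    have e2 : ¬ (l - 1 = l) := by omega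
    simpa [e1, e2, show l + 2 - 1 = l + 1 by omega, show l + 2 - 3 = l - 1 by omega] using h1

/-- Left multiplication by `b e_i` has image in the span of `e_i`, `e_{i+1}` and, if `i = n - 3`,
`e_0`. Coordinate `i` of the product comes from `w_{i-1}` and the extra coordinate `0` from
`w_{n-1}`; both vanish for a fixed vector, so only `e_{i+1}`, with eigenvalue `b`, survives. -/
theorem eq_single_of_edgeBracket_eq_self (hn : 4 ≤ n) {v w : Fin n → F} {b : F} {i : ℕ}
    (hi : i + 1 < n) (hv : v = Pi.single ⟨i, by omega⟩ b) (hw : edgeBracket v w = w)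
    (hw0 : w ≠ 0) : b = 1 ∧ ∃ a, w = Pi.single ⟨i + 1, hi⟩ a := by
  have hs : ∀ (j : ℕ) (hj : j + 1 < n), (if j = i then b else 0) * w ⟨j + 1, hj⟩ -
      (if j + 1 = i then b else 0) * w ⟨j, by omega⟩ = w ⟨j + 1, hj⟩ := by
    intro j hj
    have := congrFun hw ⟨j + 1, hj⟩
    rw [edgeBracket_succ, hv] at this
    simpa only [Pi.single_apply, Fin.mk.injEq] using this
  have hz : (if n - 3 = i then b else 0) * w ⟨n - 1, by omega⟩ = w ⟨0, by omega⟩ := by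
    have := congrFun hw ⟨0, by omega⟩
    rw [edgeBracket_zero, hv] at this
    simpa only [Pi.single_apply, Fin.mk.injEq, if_neg (show ¬ (n - 1 = i) by omega), zero_mul,
      sub_zero] using this
  have far : ∀ (j : ℕ) (hj : j + 1 < n), j ≠ i → j + 1 ≠ i → w ⟨j + 1, hj⟩ = 0 := by
    intro j hj h1 h2
    simpa [h1, h2] using (hs j hj).symm
  have w0 : w ⟨0, by omega⟩ = 0 := by
    rw [← hz]
    split_ifs with h
    · have h3 := far (n - 2) (by omega) (by omega) (by omega)
      have h4 : w ⟨n - 1, by omega⟩ = 0 := by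
        rw [← h3]
        congr 2
        omega
      rw [h4, mul_zero]
    · rw [zero_mul]
  have wi : ∀ (j : ℕ) (hj : j < n), j ≠ i + 1 → w ⟨j, hj⟩ = 0 := by
    intro j hj hne
    rcases j with _ | j
    · exact w0
    · by_cases h2 : j + 1 = i
      · have hprev : w ⟨j, by omega⟩ = 0 := by
          rcases j with _ | l
          · exact w0
          · exact far l (by omega) (by omega) (by omega)
        have := hs j hj
        rw [hprev, if_neg (by omega)] at this
        simpa using this.symm
      · exact far j hj (by omega) h2
  have hwe : w = Pi.single ⟨i + 1, hi⟩ (w ⟨i + 1, hi⟩) := by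
    ext ⟨j, hj⟩
    by_cases h : j = i + 1
    · subst h
      simp
    · rw [wi j hj h, Pi.single_apply, if_neg (by simpa using h)]
  refine ⟨?_, _, hwe⟩
  have hne : w ⟨i + 1, hi⟩ ≠ 0 := by
    intro h
    rw [h, Pi.single_zero] at hwe
    exact hw0 hwe
  have := hs i hi
  rw [if_pos rfl, if_neg (by omega), zero_mul, sub_zero] at this
  exact mul_right_cancel₀ hne (this.trans (one_mul _).symm)

/-- The anticommutative algebra defined by `edgeBracket` has no nontrivial automorphism. -/
theorem eq_single_of_edgeBracket (hn : 4 ≤ n) (r : Fin n → Fin n → F)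
    (hspan : ∀ u : Fin n → F, ∃ a : Fin n → F, u = ∑ k, a k • r k) (hne : ∀ i, r i ≠ 0)
    (hzero : ∀ k : Fin n, 1 ≠ (k : ℕ) → edgeBracket (r ⟨0, by omega⟩) (r k) = 0)
    (hsucc : ∀ (i : ℕ) (h : i + 1 < n),
      edgeBracket (r ⟨i, by omega⟩) (r ⟨i + 1, h⟩) = r ⟨i + 1, h⟩)
    (hlast : edgeBracket (r ⟨n - 3, by omega⟩) (r ⟨n - 1, by omega⟩) = r ⟨0, by omega⟩)
    (i : Fin n) : r i = Pi.single i 1 := by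
  have h0 : ∃ a, r ⟨0, by omega⟩ = Pi.single ⟨0, by omega⟩ a := by
    refine ⟨r ⟨0, by omega⟩ ⟨0, by omega⟩, ?_⟩
    -- Only `r_1` has a nonzero product with `r_0`, so left multiplication by `r_0` has rank at most
    -- one.
    have key := eq_zero_of_edgeBracket_rank_le_one hn (v := r ⟨0, by omega⟩)
      (w := r ⟨1, by omega⟩) (by
        intro u
        obtain ⟨a, rfl⟩ := hspan u
        refine ⟨a ⟨1, by omega⟩, ?_⟩
        rw [edgeBracket_sum_smul, Finset.sum_eq_single ⟨1, by omega⟩]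
        · rw [hsucc 0 (by omega)]
        · intro k _ hk
          rw [hzero k (fun h => hk (Fin.ext h.symm)), smul_zero]
        · simp)
    ext k
    by_cases hk : (k : ℕ) = 0
    · have hk0 : k = ⟨0, by omega⟩ := Fin.ext hk
      rw [hk0, Pi.single_eq_same]
    · rw [key k (by omega), Pi.single_apply, if_neg (fun h => hk (by rw [h]))]
  have hall : ∀ (i : ℕ) (h : i < n), ∃ a, r ⟨i, h⟩ = Pi.single ⟨i, h⟩ a := by
    intro i
    induction i with
    | zero => exact fun _ => h0
    | succ i ih =>
      intro h
      obtain ⟨a, ha⟩ := ih (by omega)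
      exact (eq_single_of_edgeBracket_eq_self hn h ha (hsucc i h) (hne _)).2
  have hone : ∀ (i : ℕ) (h : i + 1 < n), r ⟨i, by omega⟩ = Pi.single ⟨i, by omega⟩ 1 := by
    intro i h
    obtain ⟨a, ha⟩ := hall i (by omega)
    rw [ha, (eq_single_of_edgeBracket_eq_self hn h ha (hsucc i h) (hne _)).1]
  obtain ⟨i, hi⟩ := i
  by_cases h : i + 1 < n
  · exact hone i h
  · obtain rfl : i = n - 1 := by omega
    obtain ⟨a, ha⟩ := hall (n - 1) hi
    -- The chain of fixed-vector equations leaves the scalar of the last vector free; the closing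
    -- relation `[r_{n-3}, r_{n-1}] = r_0` normalizes it.
    have := congrFun hlast ⟨0, by omega⟩
    rw [edgeBracket_zero, hone (n - 3) (by omega), hone 0 (by omega), ha] at this
    have e1 : ¬ (n - 1 = n - 3) := by omega
    simp only [Pi.single_apply, Fin.mk.injEq, e1, if_true, if_false] at this
    rw [ha]
    congr 1
    simpa using this

end Rigidity

/-! ### Power frames, wedge coordinates and the rigidity of the matrix -/

/-- An additive group `B` together with an embedding `ι` of `𝔽_p^n × 𝔽_p^m` and a projection `π`
onto `𝔽_p^n` whose kernel is the image of `ι`, such that multiplication by `p` is induced by the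
inclusion of the first factor, and such that block triangular matrices lift to `B`. -/
structure PowerFrame (p n m : ℕ) (B : Type*) [AddCommGroup B] where
  ι : (Fin n ⊕ Fin m → ZMod p) →+ B
  π : B →+ (Fin n → ZMod p)
  ι_injective : Function.Injective ι
  π_surjective : Function.Surjective π
  π_ι : ∀ w, π (ι w) = 0
  exists_of_π_eq_zero : ∀ b, π b = 0 → ∃ w, ι w = b
  nsmul_eq : ∀ b, p • b = ι (Sum.elim (π b) 0)
  exists_lift : ∀ (A : Matrix (Fin n) (Fin n) (ZMod p)) (X : Matrix (Fin n) (Fin m) (ZMod p))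
    (M : Matrix (Fin m) (Fin m) (ZMod p)),
    ∃ α : B →+ B, ∀ w, α (ι w) = ι ((Matrix.fromBlocks A X 0 M).mulVec w)

/-- The coordinates `u_a v_b - u_b v_a` of `u ∧ v`, where `(a, b)` runs over the family `ε`. -/
def wedge {σ : Type*} {n : ℕ} {F : Type*} [CommRing F] (ε : σ → Fin n × Fin n)
    (u v : Fin n → F) (s : σ) : F :=
  u (ε s).1 * v (ε s).2 - u (ε s).2 * v (ε s).1

section Wedge

variable {σ : Type*} {n : ℕ} {F : Type*} [CommRing F] (ε : σ → Fin n × Fin n)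

theorem wedge_add_left (u u' v : Fin n → F) :
    wedge ε (u + u') v = wedge ε u v + wedge ε u' v := by
  ext s
  simp only [wedge, Pi.add_apply]
  ring

theorem wedge_add_right (u v v' : Fin n → F) :
    wedge ε u (v + v') = wedge ε u v + wedge ε u v' := by
  ext s
  simp only [wedge, Pi.add_apply]
  ring

theorem wedge_self (u : Fin n → F) : wedge ε u u = 0 := by
  ext s
  simp only [wedge, Pi.zero_apply]
  ring

theorem wedge_swap (u v : Fin n → F) : wedge ε u v = -wedge ε v u := by
  ext s
  simp only [wedge, Pi.neg_apply]
  ring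

theorem wedge_zero_left (v : Fin n → F) : wedge ε 0 v = 0 := by
  ext s
  simp [wedge]

theorem wedge_zero_right (u : Fin n → F) : wedge ε u 0 = 0 := by
  ext s
  simp [wedge]

theorem wedge_neg_right (u v : Fin n → F) : wedge ε u (-v) = -wedge ε u v := by
  ext s
  simp only [wedge, Pi.neg_apply]
  ring

theorem wedge_single [DecidableEq σ] (hinj : Function.Injective ε)
    (hlt : ∀ s, (ε s).1 < (ε s).2) (s : σ) (a : F) :
    wedge ε (Pi.single (ε s).1 a) (Pi.single (ε s).2 1) = Pi.single s a := by
  ext t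
  have h2 : ¬ ((ε t).2 = (ε s).1 ∧ (ε t).1 = (ε s).2) := by
    rintro ⟨h, h'⟩
    have := hlt t
    rw [h, h'] at this
    exact absurd (hlt s) this.asymm
  by_cases hts : t = s
  · subst hts
    simp [wedge, (hlt t).ne]
  · have h1 : ¬ ((ε t).1 = (ε s).1 ∧ (ε t).2 = (ε s).2) :=
      fun h => hts (hinj (Prod.ext h.1 h.2))
    have e1 : (Pi.single (ε s).1 a : Fin n → F) (ε t).1 *
        (Pi.single (ε s).2 1 : Fin n → F) (ε t).2 = 0 := by
      by_cases h : (ε t).1 = (ε s).1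
      · rw [Pi.single_apply (ε s).2, if_neg (fun h' => h1 ⟨h, h'⟩), mul_zero]
      · rw [Pi.single_apply, if_neg h, zero_mul]
    have e2 : (Pi.single (ε s).1 a : Fin n → F) (ε t).2 *
        (Pi.single (ε s).2 1 : Fin n → F) (ε t).1 = 0 := by
      by_cases h : (ε t).2 = (ε s).1
      · rw [Pi.single_apply (ε s).2, if_neg (fun h' => h2 ⟨h, h'⟩), mul_zero]
      · rw [Pi.single_apply, if_neg h, zero_mul]
    rw [wedge, e1, e2, sub_zero, Pi.single_apply, if_neg hts]

end Wedge

/-- A bijection `ε` of an index set with the pairs `a < b` in `Fin n` that extends `edge n`. -/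
structure IsEdgeOrdering {n m : ℕ} (ε : Fin n ⊕ Fin m → Fin n × Fin n) : Prop where
  injective : Function.Injective ε
  lt : ∀ s, (ε s).1 < (ε s).2
  surj : ∀ j k, j < k → ∃ s, ε s = (j, k)
  inl : ∀ i, ε (Sum.inl i) = edge n i

/-- An additive bijection of `𝔽_p^n` that is compatible with `wedge` and with the embedding of
`𝔽_p^n` into the index set of an edge ordering is trivial. -/
theorem IsEdgeOrdering.eq_id {n m : ℕ} {F : Type*} [Field F] {ε : Fin n ⊕ Fin m → Fin n × Fin n}
    (hε : IsEdgeOrdering ε) (hn : 4 ≤ n) (A : (Fin n → F) →ₗ[F] (Fin n → F))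
    (hA : Function.Surjective A)
    (h : ∀ i, wedge ε (A (Pi.single (edge n i).1 1)) (A (Pi.single (edge n i).2 1)) =
      Sum.elim (A (Pi.single i 1)) 0) : A = LinearMap.id := by
  have hM : ∀ j i, LinearMap.toMatrix' A j i = A (Pi.single i 1) j := fun j i => by
    rw [LinearMap.toMatrix'_apply]
  -- The hypothesis concerns columns of the matrix of `A`; read by rows, coordinate `s` gives the
  -- product of the two rows indexed by `ε s`. It is row `l` for `s = inl l` and zero for `s = inr
  -- _`.
  have hbr : ∀ (s : Fin n ⊕ Fin m) (i : Fin n),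
      edgeBracket (LinearMap.toMatrix' A (ε s).1) (LinearMap.toMatrix' A (ε s).2) i =
        (Sum.elim (A (Pi.single i 1)) 0 : Fin n ⊕ Fin m → F) s := by
    intro s i
    rw [← h i]
    simp only [edgeBracket, hM, wedge]
    ring
  have hedge : ∀ l : Fin n, edgeBracket (LinearMap.toMatrix' A (edge n l).1)
      (LinearMap.toMatrix' A (edge n l).2) = LinearMap.toMatrix' A l := by
    intro l
    ext i
    have := hbr (Sum.inl l) i
    rw [hε.inl] at this
    rw [this, Sum.elim_inl, hM]
  have hunit : IsUnit (LinearMap.toMatrix' A) := by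
    have hbij : Function.Bijective A := ⟨LinearMap.injective_iff_surjective.2 hA, hA⟩
    have := (Module.End.isUnit_iff A).2 hbij
    exact this.map (LinearMap.toMatrixAlgEquiv' (R := F) (n := Fin n))
  have key := eq_single_of_edgeBracket hn (LinearMap.toMatrix' A) (by
      intro u
      refine ⟨Matrix.vecMul u (LinearMap.toMatrix' A)⁻¹, ?_⟩
      have : Matrix.vecMul (Matrix.vecMul u (LinearMap.toMatrix' A)⁻¹) (LinearMap.toMatrix' A)
          = u := by
        rw [Matrix.vecMul_vecMul, Matrix.nonsing_inv_mul _
          ((Matrix.isUnit_iff_isUnit_det _).1 hunit), Matrix.vecMul_one]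
      rw [← Matrix.vecMul_eq_sum, this]) (by
      intro i hi
      obtain ⟨x, hx⟩ := hA (Pi.single i 1)
      have h1 := congrFun hx i
      rw [← LinearMap.toMatrix'_mulVec, Matrix.mulVec, hi, zero_dotProduct] at h1
      simp at h1) (by
      intro k hk
      by_cases hk0 : (k : ℕ) = 0
      · rw [show k = ⟨0, by omega⟩ from Fin.ext hk0]
        ext i
        simp only [edgeBracket, Pi.zero_apply]
        ring
      · obtain ⟨s, hs⟩ := hε.surj ⟨0, by omega⟩ k (Fin.lt_def.2 (by simp only; omega))
        ext i
        have := hbr s i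
        rw [hs] at this
        rw [this]
        rcases s with l | s
        · exfalso
          rw [hε.inl, edge] at hs
          split_ifs at hs with h0 <;> simp only [Prod.mk.injEq, Fin.ext_iff] at hs <;> omega
        · rfl) (by
      intro i hi
      simpa [edge] using hedge ⟨i + 1, hi⟩) (by
      simpa [edge] using hedge ⟨0, by omega⟩)
  apply LinearMap.toMatrix'.injective
  ext i j
  rw [key, LinearMap.toMatrix'_id, Matrix.one_eq_pi_single]

/-! ### Automorphisms of the wedge product group -/

namespace PowerFrame

variable {p n m : ℕ} {B : Type*} [AddCommGroup B] (f : PowerFrame p n m B)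

/-- The additive maps `B → B` that factor through an additive map from `B / ker π` to `ker π`. -/
def IsLow (φ : B →+ B) : Prop :=
  (∀ b, f.π (φ b) = 0) ∧ ∀ b, f.π b = 0 → φ b = 0

/-- Identifies `ker π` with the `p`-torsion, so every additive endomorphism preserves it. -/
theorem nsmul_eq_zero_iff (b : B) : p • b = 0 ↔ f.π b = 0 := by
  rw [f.nsmul_eq, map_eq_zero_iff f.ι f.ι_injective]
  constructor
  · intro h
    ext i
    exact congrFun h (Sum.inl i)
  · intro h
    rw [h]
    ext (i | i) <;> rfl

theorem isLow_nsmul : f.IsLow (p • AddMonoidHom.id B) :=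
  ⟨fun b => by simp [f.nsmul_eq, f.π_ι], fun b h => by simp [(f.nsmul_eq_zero_iff b).2 h]⟩

theorem IsLow.add {φ ψ : B →+ B} (hφ : f.IsLow φ) (hψ : f.IsLow ψ) : f.IsLow (φ + ψ) :=
  ⟨fun b => by simp [hφ.1, hψ.1], fun b h => by simp [hφ.2 b h, hψ.2 b h]⟩

theorem IsLow.map_add_of_π {φ : B →+ B} (hφ : f.IsLow φ) {b w : B} (h : f.π w = 0) :
    φ (b + w) = φ b := by
  rw [map_add, hφ.2 w h, add_zero]

theorem π_map_eq_zero (α : B →+ B) {b : B} (h : f.π b = 0) : f.π (α b) = 0 := by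
  rw [← f.nsmul_eq_zero_iff] at h ⊢
  rw [← map_nsmul, h, map_zero]

theorem eq_of_π_eq {X : Type*} [AddCommGroup X] {ψ : B →+ X} (hψ : ∀ b, f.π b = 0 → ψ b = 0)
    {x y : B} (h : f.π x = f.π y) : ψ x = ψ y := by
  rw [← sub_eq_zero, ← map_sub]
  exact hψ _ (by rw [map_sub, h, sub_self])

/-- An additive map that vanishes on `ker π` factors through `π` as a linear map. -/
theorem exists_linear {X : Type*} [AddCommGroup X] [Module (ZMod p) X] (ψ : B →+ X)
    (hψ : ∀ b, f.π b = 0 → ψ b = 0) :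
    ∃ L : (Fin n → ZMod p) →ₗ[ZMod p] X, ∀ b, L (f.π b) = ψ b := by
  have hlift : ∀ v, f.π (Function.surjInv f.π_surjective v) = v :=
    Function.surjInv_eq f.π_surjective
  refine ⟨AddMonoidHom.toZModLinearMap p
    { toFun := fun v => ψ (Function.surjInv f.π_surjective v)
      map_zero' := hψ _ (hlift 0)
      map_add' := fun u v => ?_ }, fun b => ?_⟩
  · rw [← map_add]
    exact f.eq_of_π_eq hψ (by rw [map_add, hlift, hlift, hlift])
  · exact f.eq_of_π_eq hψ (hlift _)

/-- Twice an element of the image of `ι` determines the element if `p` is odd. -/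
theorem eq_of_two_nsmul_eq (hp : Odd p) {x y : B} (hx : f.π x = 0)
    (hy : f.π y = 0) (h : 2 • x = 2 • y) : x = y := by
  obtain ⟨k, hk⟩ := hp
  have h2 : 2 • (x - y) = 0 := by rw [smul_sub, h, sub_self]
  have h3 : p • (x - y) = 0 := (f.nsmul_eq_zero_iff _).2 (by rw [map_sub, hx, hy, sub_self])
  rw [hk, add_smul, mul_comm, mul_smul, h2, smul_zero, zero_add, one_smul] at h3
  exact sub_eq_zero.1 h3

section Group

variable [Group B] {ε : Fin n ⊕ Fin m → Fin n × Fin n}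

/-- The group law `x * y = x + y + ι (π x ∧ π y)` on `B`. -/
def IsWedgeProduct (f : PowerFrame p n m B) (ε : Fin n ⊕ Fin m → Fin n × Fin n) : Prop :=
  ∀ x y : B, x * y = x + y + f.ι (wedge ε (f.π x) (f.π y))

variable {f}

theorem IsWedgeProduct.one_eq_zero (h : f.IsWedgeProduct ε) : (1 : B) = 0 := by
  have := h 1 1
  rw [mul_one, wedge_self, map_zero, add_zero] at this
  exact left_eq_add.1 this

theorem IsWedgeProduct.mul_eq_add (h : f.IsWedgeProduct ε) {x y : B} (hx : f.π y = 0) :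
    x * y = x + y := by
  rw [h, hx, wedge_zero_right, map_zero, add_zero]

theorem IsWedgeProduct.inv_eq_neg (h : f.IsWedgeProduct ε) (x : B) : x⁻¹ = -x := by
  refine inv_eq_of_mul_eq_one_right ?_
  rw [h, map_neg, wedge_neg_right, wedge_self, neg_zero, map_zero, add_zero, add_neg_cancel,
    h.one_eq_zero]

theorem IsWedgeProduct.pow_eq_nsmul (h : f.IsWedgeProduct ε) (x : B) (k : ℕ) :
    x ^ k = k • x := by
  induction k with
  | zero => rw [pow_zero, zero_nsmul, h.one_eq_zero]
  | succ k ih =>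
    rw [pow_succ, ih, h, succ_nsmul, map_nsmul]
    have : wedge ε (k • f.π x) (f.π x) = 0 := by
      ext s
      simp only [wedge, Pi.smul_apply, nsmul_eq_mul, Pi.zero_apply]
      ring
    rw [this, map_zero, add_zero]

theorem IsWedgeProduct.mul_eq_mul_swap (h : f.IsWedgeProduct ε) (x y : B) :
    x * y = (y * x) * (2 • f.ι (wedge ε (f.π x) (f.π y))) := by
  rw [h.mul_eq_add (x := y * x) (by rw [map_nsmul, f.π_ι, smul_zero]), h x y, h y x,
    wedge_swap ε (f.π y), map_neg]
  abel

theorem IsWedgeProduct.π_mulEquiv (h : f.IsWedgeProduct ε) (β : B ≃* B) {b : B}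
    (hb : f.π b = 0) : f.π (β b) = 0 := by
  rw [← f.nsmul_eq_zero_iff, ← h.pow_eq_nsmul] at hb ⊢
  rw [← map_pow, hb, ← h.one_eq_zero, map_one]

/-- Commutators determine twice the wedge, and 2 is invertible on `ker π`. -/
theorem IsWedgeProduct.mulEquiv_ι_wedge (h : f.IsWedgeProduct ε) (hp : Odd p) (β : B ≃* B)
    (x y : B) : β (f.ι (wedge ε (f.π x) (f.π y))) = f.ι (wedge ε (f.π (β x)) (f.π (β y))) := by
  refine f.eq_of_two_nsmul_eq hp (h.π_mulEquiv β (f.π_ι _)) (f.π_ι _) ?_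
  have h1 := congrArg β (h.mul_eq_mul_swap x y)
  rw [map_mul, map_mul, map_mul, h.mul_eq_mul_swap (β x), mul_right_inj,
    ← h.pow_eq_nsmul _ 2, ← h.pow_eq_nsmul _ 2, map_pow] at h1
  rw [← h.pow_eq_nsmul _ 2, ← h.pow_eq_nsmul _ 2, h1]

/-- As in the Baer correspondence, addition is recovered from the group law by removing the wedge
term, which automorphisms respect. -/
theorem IsWedgeProduct.mulEquiv_add (h : f.IsWedgeProduct ε) (hp : Odd p) (β : B ≃* B)
    (x y : B) : β (x + y) = β x + β y := by
  have key : ∀ x y : B, x + y = (x * y) * (f.ι (wedge ε (f.π x) (f.π y)))⁻¹ := by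
    intro x y
    rw [h.inv_eq_neg, h.mul_eq_add (by rw [map_neg, f.π_ι, neg_zero]), h]
    abel
  rw [key, map_mul, map_mul, map_inv, h.mulEquiv_ι_wedge hp, ← key]

/-- All automorphisms of `B` with the wedge product are central. -/
theorem IsWedgeProduct.exists_isLow_of_mulEquiv [Fact p.Prime] (h : f.IsWedgeProduct ε) (hp : Odd p)
    (hn : 4 ≤ n) (hε : IsEdgeOrdering ε) (β : B ≃* B) :
    ∃ φ : B →+ B, f.IsLow φ ∧ ∀ b, β b = b + φ b := by
  let βa : B →+ B := { toFun := β, map_zero' := by rw [← h.one_eq_zero, map_one, h.one_eq_zero]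
                       map_add' := h.mulEquiv_add hp β }
  obtain ⟨A, hA⟩ := f.exists_linear (f.π.comp βa) fun b hb => h.π_mulEquiv β hb
  replace hA : ∀ b, A (f.π b) = f.π (β b) := hA
  have hsurj : Function.Surjective A := by
    intro v
    obtain ⟨b, rfl⟩ := f.π_surjective v
    exact ⟨f.π (β.symm b), by rw [hA, β.apply_symm_apply]⟩
  have hwedge : ∀ u v, β (f.ι (wedge ε u v)) = f.ι (wedge ε (A u) (A v)) := by
    intro u v
    obtain ⟨x, rfl⟩ := f.π_surjective u
    obtain ⟨y, rfl⟩ := f.π_surjective v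
    rw [hA, hA, h.mulEquiv_ι_wedge hp]
  have hid : A = LinearMap.id := by
    refine hε.eq_id hn A hsurj fun i => f.ι_injective ?_
    -- For an edge `i` the vector `ι e_i` is both a wedge of basis vectors and `p • x` with `π x =
    -- e_i`; the two descriptions of its image under `β` give the compatibility required of `A`.
    rw [← hwedge, ← hε.inl, wedge_single ε hε.injective hε.lt]
    obtain ⟨x, hx⟩ := f.π_surjective (Pi.single i 1)
    have e : (Pi.single (Sum.inl i) 1 : Fin n ⊕ Fin m → ZMod p) = Sum.elim (f.π x) 0 := by
      rw [hx]
      ext (j | j) <;> simp [Pi.single_apply]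
    rw [e, ← f.nsmul_eq, ← hx, hA, ← f.nsmul_eq]
    exact map_nsmul βa p x
  -- Every coordinate vector of `ker π` is a wedge, so `A = 1` makes `β` trivial on `ker π`.
  have hι : βa.comp f.ι = f.ι := by
    refine AddMonoidHom.functions_ext _ _ _ fun s a => ?_
    rw [AddMonoidHom.comp_apply, ← wedge_single ε hε.injective hε.lt]
    exact (hwedge _ _).trans (by rw [hid]; rfl)
  refine ⟨βa - AddMonoidHom.id B, ⟨fun b => ?_, fun b hb => ?_⟩, fun b => ?_⟩
  · have := hA b
    rw [hid] at this
    rw [AddMonoidHom.sub_apply, map_sub, sub_eq_zero]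
    exact this.symm
  · obtain ⟨w, rfl⟩ := f.exists_of_π_eq_zero b hb
    rw [AddMonoidHom.sub_apply, sub_eq_zero]
    exact DFunLike.congr_fun hι w
  · rw [AddMonoidHom.sub_apply, AddMonoidHom.id_apply, add_sub_cancel]
    rfl

end Group

end PowerFrame

/-! ### Symmetric bilinear and quadratic maps -/

/-- The symmetric bilinear map with values `s s(i, j)` on the standard basis. -/
def polarForm {n : ℕ} {σ F : Type*} [CommRing F] (s : Sym2 (Fin n) → σ → F)
    (u v : Fin n → F) : σ → F :=
  ∑ i, ∑ j, (u i * v j) • s s(i, j)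

section PolarForm

variable {n : ℕ} {σ F : Type*} [CommRing F]

theorem polarForm_comm (s : Sym2 (Fin n) → σ → F) (u v : Fin n → F) :
    polarForm s u v = polarForm s v u := by
  unfold polarForm
  rw [Finset.sum_comm]
  refine Finset.sum_congr rfl fun i _ => Finset.sum_congr rfl fun j _ => ?_
  rw [mul_comm, Sym2.eq_swap]

theorem polarForm_add_left (s : Sym2 (Fin n) → σ → F) (u u' v : Fin n → F) :
    polarForm s (u + u') v = polarForm s u v + polarForm s u' v := by
  simp only [polarForm, Pi.add_apply, add_mul, add_smul, Finset.sum_add_distrib]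

theorem polarForm_add_right (s : Sym2 (Fin n) → σ → F) (u v v' : Fin n → F) :
    polarForm s u (v + v') = polarForm s u v + polarForm s u v' := by
  simp only [polarForm, Pi.add_apply, mul_add, add_smul, Finset.sum_add_distrib]

theorem add_polarForm (s s' : Sym2 (Fin n) → σ → F) (u v : Fin n → F) :
    polarForm (s + s') u v = polarForm s u v + polarForm s' u v := by
  simp only [polarForm, Pi.add_apply, smul_add, Finset.sum_add_distrib]

theorem zero_polarForm (u v : Fin n → F) :
    polarForm (0 : Sym2 (Fin n) → σ → F) u v = 0 := by
  simp [polarForm]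

theorem polarForm_zero (s : Sym2 (Fin n) → σ → F) (v : Fin n → F) : polarForm s 0 v = 0 := by
  simp [polarForm]

theorem polarForm_single (s : Sym2 (Fin n) → σ → F) (i j : Fin n) :
    polarForm s (Pi.single i 1) (Pi.single j 1) = s s(i, j) := by
  simp [polarForm, Pi.single_apply, Finset.sum_ite_eq', ite_smul]

theorem polarForm_add_self (s : Sym2 (Fin n) → σ → F) (u v : Fin n → F) :
    polarForm s (u + v) (u + v) = polarForm s u u + 2 • polarForm s u v + polarForm s v v := by
  rw [polarForm_add_left, polarForm_add_right, polarForm_add_right, polarForm_comm s v u]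
  abel

end PolarForm

namespace PowerFrame

variable {p n m : ℕ} {B : Type*} [AddCommGroup B] (f : PowerFrame p n m B)

/-- The quadratic map from `B / ker π` to `ker π` with coefficients `s`. -/
def quad (s : Sym2 (Fin n) → Fin n ⊕ Fin m → ZMod p) (b : B) : B :=
  f.ι (polarForm s (f.π b) (f.π b))

theorem π_quad (s) (b : B) : f.π (f.quad s b) = 0 := f.π_ι _

theorem quad_eq_of_π_eq (s) {b b' : B} (h : f.π b = f.π b') : f.quad s b = f.quad s b' := by
  rw [quad, h, quad]

theorem add_quad (s s') (b : B) : f.quad (s + s') b = f.quad s b + f.quad s' b := by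
  rw [quad, add_polarForm, map_add]
  rfl

theorem zero_quad (b : B) : f.quad 0 b = 0 := by
  rw [quad, zero_polarForm, map_zero]

theorem quad_zero (s) : f.quad s 0 = 0 := by
  rw [quad, map_zero, polarForm_zero, map_zero]

/-- The additive map `b ↦ ι (polarForm s (π b) v)`. -/
def polarLeft (s : Sym2 (Fin n) → Fin n ⊕ Fin m → ZMod p) (v : Fin n → ZMod p) : B →+ B where
  toFun b := f.ι (polarForm s (f.π b) v)
  map_zero' := by rw [map_zero, polarForm_zero, map_zero]
  map_add' x y := by rw [map_add, polarForm_add_left, map_add]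

theorem isLow_polarLeft (s) (v : Fin n → ZMod p) : f.IsLow (f.polarLeft s v) :=
  ⟨fun _ => f.π_ι _, fun b h => by
    show f.ι (polarForm s (f.π b) v) = 0
    rw [h, polarForm_zero, map_zero]⟩

theorem quad_add (s) (x y : B) :
    f.quad s (x + y) = f.quad s x + 2 • f.polarLeft s (f.π y) x + f.quad s y := by
  rw [quad, map_add, polarForm_add_self, map_add, map_add, map_nsmul]
  rfl

/-- A quadratic map that is additive has zero coefficients if `p` is odd. -/
theorem eq_zero_of_quad_add (hp : Odd p) {s : Sym2 (Fin n) → Fin n ⊕ Fin m → ZMod p}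
    (h : ∀ x y : B, f.quad s (x + y) = f.quad s x + f.quad s y) : s = 0 := by
  ext z : 1
  induction z with
  | _ i j =>
    obtain ⟨x, hx⟩ := f.π_surjective (Pi.single i 1)
    obtain ⟨y, hy⟩ := f.π_surjective (Pi.single j 1)
    have h1 : f.polarLeft s (f.π y) x = 0 := by
      refine f.eq_of_two_nsmul_eq hp ((f.isLow_polarLeft s _).1 _) (map_zero _) ?_
      have := h x y
      rw [quad_add, add_left_inj, add_eq_left] at this
      rw [this, smul_zero]
    apply f.ι_injective
    rw [← polarForm_single s i j, ← hx, ← hy, Pi.zero_apply, map_zero]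
    exact h1

/-- A symmetric biadditive map from `B / ker π` to `ker π` is given by a symmetric family of
coefficients. -/
theorem exists_polarForm (D : B → B → B) (hadd : ∀ x x' y, D (x + x') y = D x y + D x' y)
    (hcomm : ∀ x y, D x y = D y x) (hπ : ∀ x y, f.π (D x y) = 0)
    (hzero : ∀ w y, f.π w = 0 → D w y = 0) :
    ∃ s, ∀ x y, D x y = f.ι (polarForm s (f.π x) (f.π y)) := by
  choose d hd using fun x y => f.exists_of_π_eq_zero _ (hπ x y)
  have dadd : ∀ x x' y, d (x + x') y = d x y + d x' y := fun x x' y =>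
    f.ι_injective (by rw [map_add, hd, hd, hd, hadd])
  have dcomm : ∀ x y, d x y = d y x := fun x y => f.ι_injective (by rw [hd, hd, hcomm])
  have dzero : ∀ w y, f.π w = 0 → d w y = 0 := fun w y hw =>
    f.ι_injective (by rw [hd, hzero w y hw, map_zero])
  choose l hl using fun i : Fin n => f.π_surjective (Pi.single i 1)
  have expand : ∀ x y, d x y = ∑ i, f.π x i • d (l i) y := by
    intro x y
    obtain ⟨L, hL⟩ := f.exists_linear
      { toFun := fun x => d x y, map_zero' := dzero 0 y (map_zero _)
        map_add' := fun x x' => dadd x x' y } fun w hw => dzero w y hw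
    replace hL : ∀ x, L (f.π x) = d x y := hL
    rw [← hL, LinearMap.pi_apply_eq_sum_univ]
    refine Finset.sum_congr rfl fun i _ => ?_
    rw [← hL, hl]
    congr 2
    ext j
    simp [Pi.single_apply, eq_comm]
  refine ⟨Sym2.lift ⟨fun i j => d (l i) (l j), fun i j => dcomm _ _⟩, fun x y => ?_⟩
  rw [← hd, expand, polarForm]
  congr 1
  refine Finset.sum_congr rfl fun i _ => ?_
  rw [dcomm, expand, Finset.smul_sum]
  refine Finset.sum_congr rfl fun j _ => ?_
  rw [smul_smul, dcomm, Sym2.lift_mk]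

/-- The permutation `b ↦ b + quad s b`. -/
def quadPerm (s : Sym2 (Fin n) → Fin n ⊕ Fin m → ZMod p) : Equiv.Perm B where
  toFun b := b + f.quad s b
  invFun b := b - f.quad s b
  left_inv b := by
    beta_reduce
    rw [f.quad_eq_of_π_eq s (b := b + f.quad s b) (b' := b)
      (by rw [map_add, π_quad, add_zero]), add_sub_cancel_right]
  right_inv b := by
    beta_reduce
    rw [f.quad_eq_of_π_eq s (b := b - f.quad s b) (b' := b)
      (by rw [map_sub, π_quad, sub_zero]), sub_add_cancel]

theorem quadPerm_apply (s) (b : B) : f.quadPerm s b = b + f.quad s b := rfl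

theorem quadPerm_add (s s') : f.quadPerm (s + s') = f.quadPerm s * f.quadPerm s' := by
  ext b
  rw [Equiv.Perm.mul_apply, quadPerm_apply, quadPerm_apply, quadPerm_apply,
    f.quad_eq_of_π_eq s (b := b + f.quad s' b) (b' := b) (by rw [map_add, π_quad, add_zero]),
    add_quad]
  abel

/-- The permutations `b ↦ b + φ b + t`, where `φ` is additive from `B / ker π` to `ker π`. -/
def IsLowAffine (g : Equiv.Perm B) : Prop :=
  ∃ (φ : B →+ B) (t : B), f.IsLow φ ∧ ∀ b, g b = b + φ b + t

theorem IsLowAffine.inv {g : Equiv.Perm B} (h : f.IsLowAffine g) : f.IsLowAffine g⁻¹ := by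
  obtain ⟨φ, t, hφ, hg⟩ := h
  refine ⟨-φ, φ t - t, ⟨fun b => by simp [hφ.1], fun b hb => by simp [hφ.2 b hb]⟩, fun b => ?_⟩
  rw [Equiv.Perm.inv_eq_iff_eq, hg]
  simp only [AddMonoidHom.neg_apply, map_add, map_neg, map_sub, hφ.2 _ (hφ.1 _)]
  abel

theorem IsLowAffine.of_add_right (t : B) : f.IsLowAffine (Equiv.addRight t) :=
  ⟨0, t, ⟨fun _ => by simp, fun _ _ => by simp⟩, fun b => by simp⟩

end PowerFrame

/-! ### The holomorph -/

theorem Subgroup.mem_normalizer_of_conj_mem {G : Type*} [Group G] (H : Subgroup G) (P : G → Prop)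
    (hinv : ∀ g, P g → P g⁻¹) (hconj : ∀ g, P g → ∀ h ∈ H, g * h * g⁻¹ ∈ H) {g : G} (hg : P g) :
    g ∈ Subgroup.normalizer (H : Set G) := by
  rw [Subgroup.mem_normalizer_iff]
  refine fun h => ⟨hconj g hg h, fun hh => ?_⟩
  have := hconj _ (hinv g hg) _ hh
  rwa [inv_inv, mul_assoc, inv_mul_cancel_right, ← mul_assoc, inv_mul_cancel, one_mul] at this

namespace PowerFrame

variable {p n m : ℕ} {B : Type*} [AddCommGroup B] {f : PowerFrame p n m B} [Group B]
  {ε : Fin n ⊕ Fin m → Fin n × Fin n}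

/-- Dividing `g` by `g 1` leaves an automorphism, which is `1 + φ` by rigidity; left multiplication
by `g 1` adds only a translation and another low map. -/
theorem IsWedgeProduct.mem_Hol_iff [Fact p.Prime] (h : f.IsWedgeProduct ε) (hp : Odd p)
    (hn : 4 ≤ n) (hε : IsEdgeOrdering ε) (g : Equiv.Perm B) : g ∈ Hol B ↔ f.IsLowAffine g := by
  constructor
  · intro hg
    have hmul : ∀ x y, g (x * y) = g x * ((g 1)⁻¹ * g y) := by
      intro x y
      obtain ⟨z, hz⟩ := (Subgroup.mem_normalizer_iff.1 hg (Equiv.mulRight y)).1 ⟨y, rfl⟩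
      have hz' : ∀ x, g (x * y) = g x * z := fun x => by
        have := DFunLike.congr_fun hz (g x)
        simpa using this.symm
      rw [hz' x, ← one_mul y, hz' 1, inv_mul_cancel_left]
    obtain ⟨φ, hφ, hβ⟩ := h.exists_isLow_of_mulEquiv hp hn hε
      { g.trans (Equiv.mulLeft (g 1)⁻¹) with
        map_mul' := fun x y => by simp [hmul x y, mul_assoc] }
    replace hβ : ∀ b, (g 1)⁻¹ * g b = b + φ b := hβ
    let ψ : B →+ B :=
      { toFun := fun b => f.ι (wedge ε (f.π (g 1)) (f.π b))
        map_zero' := by rw [map_zero, wedge_zero_right, map_zero]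
        map_add' := fun x y => by rw [map_add, wedge_add_right, map_add] }
    refine ⟨φ + ψ, g 1, hφ.add f ⟨fun b => f.π_ι _, fun b hb => ?_⟩, fun b => ?_⟩
    · show f.ι (wedge ε (f.π (g 1)) (f.π b)) = 0
      rw [hb, wedge_zero_right, map_zero]
    · rw [← mul_inv_cancel_left (g 1) (g b), hβ, h, map_add, hφ.1, add_zero]
      show _ = b + (φ b + f.ι (wedge ε (f.π (g 1)) (f.π b))) + g 1
      abel
  · refine Subgroup.mem_normalizer_of_conj_mem _ f.IsLowAffine (fun _ h => h.inv) ?_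
    rintro g ⟨φ, t, hφ, hg⟩ _ ⟨y, rfl⟩
    -- The last term cancels the wedge of `t` with `y` created by multiplying `g x` on the right.
    refine ⟨y + φ y - f.ι (wedge ε (f.π t) (f.π y)), ?_⟩
    rw [eq_mul_inv_iff_mul_eq]
    ext x
    simp only [Equiv.Perm.mul_apply, Equiv.coe_mulRight]
    rw [hg, hg, h x y, h (x + φ x + t)]
    simp only [map_add, map_sub, f.π_ι, hφ.1, add_zero, sub_zero, hφ.2 _ (f.π_ι _),
      wedge_add_left]
    abel

end PowerFrame

/-! ### The multiple holomorph -/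

namespace PowerFrame

variable {p n m : ℕ} {B : Type*} [AddCommGroup B] (f : PowerFrame p n m B)

/-- Quadratic maps survive composition with endomorphisms on either side because these preserve `ker
π`. This makes their group stable under conjugation by additive automorphisms. -/
theorem exists_quad_comp (s : Sym2 (Fin n) → Fin n ⊕ Fin m → ZMod p) (α β : AddMonoid.End B) :
    ∃ s', ∀ x, f.quad s' x = α (f.quad s (β x)) := by
  obtain ⟨s', hs'⟩ := f.exists_polarForm
    (fun x y => α (f.ι (polarForm s (f.π (β x)) (f.π (β y)))))
    (fun x x' y => by simp only [map_add, polarForm_add_left])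
    (fun x y => by rw [polarForm_comm])
    (fun x y => f.π_map_eq_zero α (f.π_ι _))
    (fun w y hw => by
      have h0 : f.π (β w) = 0 := f.π_map_eq_zero β hw
      rw [h0, polarForm_zero, map_zero, map_zero])
  exact ⟨s', fun x => (hs' x x).symm⟩

/-- The permutation of `B` given by an automorphism of its additive group. -/
abbrev autPerm (B : Type*) [AddCommGroup B] : (AddMonoid.End B)ˣ →* Equiv.Perm B :=
  MulAction.toPermHom _ _

theorem autPerm_apply (α : (AddMonoid.End B)ˣ) (b : B) :
    autPerm B α b = (α : AddMonoid.End B) b := rfl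

theorem end_inv_apply_self (α : (AddMonoid.End B)ˣ) (b : B) :
    (α⁻¹).val (α.val b) = b :=
  DFunLike.congr_fun α.inv_mul b

theorem end_apply_inv_self (α : (AddMonoid.End B)ˣ) (b : B) :
    α.val ((α⁻¹).val b) = b :=
  DFunLike.congr_fun α.mul_inv b

/-- An additive endomorphism of a finite group that is injective on `ker π` is invertible. -/
theorem exists_unit_of_injective [Finite B] (α : B →+ B)
    (h : ∀ b, f.π b = 0 → α b = 0 → b = 0) : ∃ u : (AddMonoid.End B)ˣ, u.val = α := by
  have hinj : Function.Injective α := by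
    refine (injective_iff_map_eq_zero α).2 fun b hb => h b ?_ hb
    rw [← f.nsmul_eq_zero_iff]
    refine h _ ?_ (by rw [map_nsmul, hb, smul_zero])
    rw [f.nsmul_eq, f.π_ι]
  let e : B ≃+ B := AddEquiv.ofBijective α (Finite.injective_iff_bijective.1 hinj)
  exact ⟨⟨α, e.symm.toAddMonoidHom, AddMonoidHom.ext fun b => e.apply_symm_apply b,
    AddMonoidHom.ext fun b => e.symm_apply_apply b⟩, rfl⟩

variable [Group B]

section Normalizer

variable {f} (hH : ∀ g : Equiv.Perm B, g ∈ Hol B ↔ f.IsLowAffine g)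

include hH

theorem addRight_mem_NHol (t : B) : Equiv.addRight t ∈ NHol B :=
  Subgroup.le_normalizer ((hH _).2 (IsLowAffine.of_add_right f t))

/-- Low maps do not see the quadratic term, so conjugation only adds `quad s (x + t) - quad s x = 2
polar(x, t) + quad s t`: a low map and a translation. -/
theorem quadPerm_mem_NHol (s : Sym2 (Fin n) → Fin n ⊕ Fin m → ZMod p) :
    f.quadPerm s ∈ NHol B := by
  refine Subgroup.mem_normalizer_of_conj_mem _ (fun g => ∃ s, g = f.quadPerm s) ?_ ?_ ⟨s, rfl⟩
  · rintro _ ⟨s, rfl⟩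
    refine ⟨-s, inv_eq_of_mul_eq_one_right ?_⟩
    rw [← quadPerm_add, add_neg_cancel]
    ext b
    rw [quadPerm_apply, zero_quad, add_zero, Equiv.Perm.one_apply]
  · rintro _ ⟨s, rfl⟩ g hg
    obtain ⟨φ, t, hφ, hg⟩ := (hH g).1 hg
    refine (hH _).2 ⟨φ + 2 • f.polarLeft s (f.π t), t + f.quad s t, hφ.add f
      ⟨fun b => ?_, fun b hb => ?_⟩, fun b => ?_⟩
    · rw [AddMonoidHom.nsmul_apply, map_nsmul, (f.isLow_polarLeft s _).1, smul_zero]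
    · rw [AddMonoidHom.nsmul_apply, (f.isLow_polarLeft s _).2 b hb, smul_zero]
    · obtain ⟨x, rfl⟩ := (f.quadPerm s).surjective b
      rw [Equiv.Perm.mul_apply, Equiv.Perm.mul_apply, Equiv.Perm.coe_inv,
        Equiv.symm_apply_apply, quadPerm_apply, hg, quadPerm_apply,
        f.quad_eq_of_π_eq s (b := x + φ x + t) (b' := x + t)
          (by rw [map_add, map_add, hφ.1, add_zero, map_add]), quad_add]
      rw [AddMonoidHom.add_apply, hφ.map_add_of_π f (f.π_quad s x), AddMonoidHom.nsmul_apply,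
        (f.isLow_polarLeft s _).map_add_of_π f (f.π_quad s x)]
      abel

theorem autPerm_mem_NHol (α : (AddMonoid.End B)ˣ) : autPerm B α ∈ NHol B := by
  refine Subgroup.mem_normalizer_of_conj_mem _ (fun g => ∃ α, g = autPerm B α) ?_ ?_ ⟨α, rfl⟩
  · rintro _ ⟨α, rfl⟩
    exact ⟨α⁻¹, (map_inv _ _).symm⟩
  · rintro _ ⟨α, rfl⟩ g hg
    obtain ⟨φ, t, hφ, hg⟩ := (hH g).1 hg
    obtain ⟨ψ, hψ⟩ : ∃ ψ : B →+ B, ∀ b, ψ b = α.val (φ ((α⁻¹).val b)) :=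
      ⟨AddMonoidHom.mk' (fun b => α.val (φ ((α⁻¹).val b))) fun x y => by simp only [map_add],
        fun _ => rfl⟩
    refine (hH _).2 ⟨ψ, α.val t, ⟨fun b => ?_, fun b hb => ?_⟩, fun b => ?_⟩
    · rw [hψ]
      exact f.π_map_eq_zero α.val (hφ.1 _)
    · have h0 : φ ((α⁻¹).val b) = 0 := hφ.2 _ (f.π_map_eq_zero (α⁻¹).val hb)
      rw [hψ, h0, map_zero]
    · rw [Equiv.Perm.mul_apply, Equiv.Perm.mul_apply, ← map_inv, autPerm_apply, autPerm_apply, hg,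
        map_add, map_add, end_apply_inv_self, hψ]

/-- `ker π` is the fixed point set of `μ : b ↦ b + p b`, which lies in `Hol`. The conjugate `g⁻¹ μ
g` is in `Hol` and fixes `0`, hence fixes `ker π` pointwise; so `μ` fixes `g w`. -/
theorem π_apply_of_mem_NHol {g : Equiv.Perm B} (hg : g ∈ NHol B) (h0 : g 0 = 0) {w : B}
    (hw : f.π w = 0) : f.π (g w) = 0 := by
  let μ : Equiv.Perm B := ⟨fun b => b + p • b, fun b => b - p • b, fun b => by
    have : p • p • b = 0 := by rw [f.nsmul_eq_zero_iff, f.nsmul_eq, f.π_ι]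
    simp [this], fun b => by
    have : p • p • b = 0 := by rw [f.nsmul_eq_zero_iff, f.nsmul_eq, f.π_ι]
    simp [this, smul_sub]⟩
  have hμ : μ ∈ Hol B := (hH _).2 ⟨_, 0, f.isLow_nsmul, fun b => (add_zero _).symm⟩
  have h1 : g⁻¹ * μ * g ∈ Hol B := by
    have := (Subgroup.mem_normalizer_iff.1 (inv_mem hg) μ).1 hμ
    rwa [inv_inv] at this
  obtain ⟨φ, t, hφ, hconj⟩ := (hH _).1 h1
  have ht : t = 0 := by
    have := hconj 0
    rw [Equiv.Perm.mul_apply, Equiv.Perm.mul_apply, h0, map_zero φ, add_zero, zero_add,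
      Equiv.Perm.inv_eq_iff_eq] at this
    apply g.injective
    rw [← this, h0]
    exact (by simp : (0 : B) + p • 0 = 0)
  have h2 := hconj w
  rw [Equiv.Perm.mul_apply, Equiv.Perm.mul_apply, hφ.2 w hw, ht, add_zero, add_zero,
    Equiv.Perm.inv_eq_iff_eq] at h2
  exact (f.nsmul_eq_zero_iff _).1 (add_eq_left.1 h2)

/-- The permutations in the multiple holomorph are the maps `b ↦ α b + q b + t` with `α` an
automorphism of the additive group and `q` quadratic from `B / ker π` to `ker π`. -/
theorem exists_of_mem_NHol [Finite B] (hp : Odd p) {θ : Equiv.Perm B} (hθ : θ ∈ NHol B) :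
    ∃ (α : (AddMonoid.End B)ˣ) (s : Sym2 (Fin n) → Fin n ⊕ Fin m → ZMod p) (t : B),
      θ = Equiv.addRight t * (f.quadPerm s * autPerm B α) := by
  obtain ⟨g, t, h0, hg, rfl⟩ : ∃ (g : Equiv.Perm B) (t : B), g 0 = 0 ∧ g ∈ NHol B ∧
      θ = Equiv.addRight t * g := by
    refine ⟨(Equiv.addRight (θ 0))⁻¹ * θ, θ 0, ?_, mul_mem (inv_mem (addRight_mem_NHol hH _)) hθ,
      (mul_inv_cancel_left _ _).symm⟩
    rw [Equiv.Perm.mul_apply, Equiv.Perm.inv_eq_iff_eq]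
    simp
  have hπ : ∀ w, f.π w = 0 → f.π (g w) = 0 := fun w => π_apply_of_mem_NHol hH hg h0
  -- Conjugating translation by `y` with `g` gives an element of `Hol`; its low part measures the
  -- failure of `g` to be additive.
  have hD : ∀ y, ∃ φ : B →+ B, f.IsLow φ ∧ ∀ x, g (x + y) - g x - g y = φ (g x) := by
    intro y
    obtain ⟨φ, t, hφ, hconj⟩ := (hH _).1 ((Subgroup.mem_normalizer_iff.1 hg _).1
      ((hH _).2 (IsLowAffine.of_add_right f y)))
    have hc : ∀ x, g (x + y) = g x + φ (g x) + t := fun x => by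
      have := hconj (g x)
      simpa using this
    have ht : g y = t := by
      have := hc 0
      rwa [h0, map_zero, add_zero, zero_add, zero_add] at this
    refine ⟨φ, hφ, fun x => ?_⟩
    rw [hc, ht]
    abel
  choose φ hφ hφg using hD
  obtain ⟨s, hs⟩ := f.exists_polarForm (fun x y => g (x + y) - g x - g y)
    (by
      intro x x' y
      have : g (x + x') = g x + g x' + φ x' (g x) := by
        rw [← hφg]
        abel
      simp only [hφg]
      rw [this, (hφ y).map_add_of_π f ((hφ x').1 _), map_add])
    (fun x y => by simp only [add_comm x y]; abel)
    (fun x y => by simp only [hφg, (hφ y).1])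
    (fun w y hw => by simp only [hφg, (hφ y).2 _ (hπ w hw)])
  -- With `p = 2k + 1`, the scalar `k + 1` is the inverse of 2 modulo `p`; halving `s` gives a
  -- quadratic map whose additivity defect is that of `g`.
  obtain ⟨k, hk⟩ := hp
  have hq2 : ∀ x, 2 • f.quad ((k + 1) • s) x = f.quad s x := by
    intro x
    have e : (2 * (k + 1)) • s = s := by
      ext z i
      have : ((2 * (k + 1) : ℕ) : ZMod p) = 1 := by
        rw [show 2 * (k + 1) = p + 1 by omega, Nat.cast_add, ZMod.natCast_self, zero_add,
          Nat.cast_one]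
      rw [Pi.smul_apply, Pi.smul_apply, nsmul_eq_mul, this, one_mul]
    rw [two_nsmul, ← add_quad, ← two_nsmul, smul_smul, e]
  have hp2 : ∀ x y, 2 • f.polarLeft ((k + 1) • s) (f.π y) x = f.polarLeft s (f.π y) x := by
    intro x y
    have h1 := hq2 (x + y)
    rw [quad_add, quad_add, smul_add, smul_add, hq2, hq2, add_left_inj, add_right_inj] at h1
    exact f.eq_of_two_nsmul_eq ⟨k, hk⟩ (by rw [map_nsmul, (f.isLow_polarLeft _ _).1, smul_zero])
      ((f.isLow_polarLeft _ _).1 _) h1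
  have hgadd : ∀ x y, g (x + y) = g x + g y + f.polarLeft s (f.π y) x := by
    intro x y
    have := hs x y
    rw [sub_sub, sub_eq_iff_eq_add] at this
    rw [this]
    exact add_comm _ _
  obtain ⟨α, hα⟩ := f.exists_unit_of_injective
    { toFun := fun x => g x - f.quad ((k + 1) • s) x
      map_zero' := by rw [h0, quad_zero, sub_zero]
      map_add' := fun x y => by
        rw [hgadd, quad_add, hp2]
        abel }
    (fun b hb h => by
      replace h : g b - f.quad ((k + 1) • s) b = 0 := h
      rw [f.quad_eq_of_π_eq _ (b' := 0) (by rw [hb, map_zero]), quad_zero, sub_zero, ← h0] at h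
      exact g.injective h)
  replace hα : ∀ x, α.val x = g x - f.quad ((k + 1) • s) x := fun x => by rw [hα]; rfl
  -- In the required factorization the quadratic map acts after `α`, so it is precomposed with
  -- `α⁻¹`.
  obtain ⟨s', hs'⟩ := f.exists_quad_comp ((k + 1) • s) 1 (α⁻¹).val
  refine ⟨α, s', t, ?_⟩
  congr 1
  ext x
  rw [Equiv.Perm.mul_apply, quadPerm_apply, autPerm_apply, hs', end_inv_apply_self, hα]
  exact (sub_add_cancel _ _).symm

/-- Membership in `Hol` expresses the quadratic map as a combination of additive ones, and an
additive quadratic map vanishes for odd `p`. -/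
theorem quadPerm_mul_autPerm_mem_Hol (hp : Odd p) {α : (AddMonoid.End B)ˣ}
    {s : Sym2 (Fin n) → Fin n ⊕ Fin m → ZMod p} (h : f.quadPerm s * autPerm B α ∈ Hol B) :
    s = 0 ∧ ∀ b, f.π b = 0 → α.val b = b := by
  obtain ⟨φ, t, hφ, h⟩ := (hH _).1 h
  replace h : ∀ b, α.val b + f.quad s (α.val b) = b + φ b + t := h
  have ht : t = 0 := by simpa [quad_zero] using (h 0).symm
  have hs : s = 0 := by
    refine f.eq_zero_of_quad_add hp fun x y => ?_
    have key : ∀ x, f.quad s x = (α⁻¹).val x + φ ((α⁻¹).val x) - x := by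
      intro x
      have := h ((α⁻¹).val x)
      rw [end_apply_inv_self, ht, add_zero] at this
      rw [← this, add_sub_cancel_left]
    simp only [key, map_add]
    abel
  refine ⟨hs, fun b hb => ?_⟩
  have := h b
  rwa [hs, zero_quad, ht, hφ.2 b hb, add_zero, add_zero, add_zero] at this

/-- `φ = α - 1` kills `ker π`, and `p φ b = φ (p b) = 0` places its image in `ker π`. -/
theorem autPerm_mem_Hol {α : (AddMonoid.End B)ˣ} (h : ∀ b, f.π b = 0 → α.val b = b) :
    autPerm B α ∈ Hol B := by
  obtain ⟨φ, hφ⟩ : ∃ φ : B →+ B, ∀ b, φ b = α.val b - b :=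
    ⟨AddMonoidHom.mk' (fun b => α.val b - b) fun x y => by
      rw [map_add]
      abel, fun _ => rfl⟩
  refine (hH _).2 ⟨φ, 0, ⟨fun b => ?_, fun b hb => ?_⟩, fun b => ?_⟩
  · have hw : f.π (p • b) = 0 := by rw [f.nsmul_eq, f.π_ι]
    rw [← f.nsmul_eq_zero_iff, ← map_nsmul, hφ, h _ hw, sub_self]
  · rw [hφ, h b hb, sub_self]
  · rw [hφ, add_sub_cancel, add_zero]
    rfl

end Normalizer

end PowerFrame

/-! ### Restriction to the `p`-torsion and block triangular matrices -/

namespace PowerFrame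

variable {p n m : ℕ} {B : Type*} [AddCommGroup B] (f : PowerFrame p n m B)

theorem exists_restrict (α : AddMonoid.End B) :
    ∃ P : Matrix (Fin n ⊕ Fin m) (Fin n ⊕ Fin m) (ZMod p),
      ∀ w, f.ι (P.mulVec w) = α (f.ι w) := by
  choose h hh using fun w => f.exists_of_π_eq_zero _ (f.π_map_eq_zero α (f.π_ι w))
  replace hh : ∀ w, f.ι (h w) = α (f.ι w) := hh
  refine ⟨LinearMap.toMatrix' (AddMonoidHom.toZModLinearMap p (AddMonoidHom.mk' h fun u v =>
    f.ι_injective ?_)), fun w => ?_⟩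
  · rw [hh, map_add, map_add, map_add, hh, hh]
  · rw [LinearMap.toMatrix'_mulVec]
    exact hh w

theorem matrix_eq_of_ι {P P' : Matrix (Fin n ⊕ Fin m) (Fin n ⊕ Fin m) (ZMod p)}
    (h : ∀ w, f.ι (P.mulVec w) = f.ι (P'.mulVec w)) : P = P' :=
  Matrix.ext_iff_mulVec.2 fun w => f.ι_injective (h w)

/-- The matrix of the restriction of an endomorphism of `B` to the image of `ι`. -/
noncomputable def restrict :
    AddMonoid.End B →* Matrix (Fin n ⊕ Fin m) (Fin n ⊕ Fin m) (ZMod p) where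
  toFun α := (f.exists_restrict α).choose
  map_one' := f.matrix_eq_of_ι fun w => by
    rw [(f.exists_restrict 1).choose_spec, Matrix.one_mulVec]
    rfl
  map_mul' α β := f.matrix_eq_of_ι fun w => by
    rw [(f.exists_restrict (α * β)).choose_spec, ← Matrix.mulVec_mulVec,
      (f.exists_restrict α).choose_spec, (f.exists_restrict β).choose_spec]
    rfl

theorem ι_restrict_mulVec (α : AddMonoid.End B) (w) :
    f.ι ((f.restrict α).mulVec w) = α (f.ι w) :=
  (f.exists_restrict α).choose_spec w

theorem restrict_eq_one_iff (α : AddMonoid.End B) :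
    f.restrict α = 1 ↔ ∀ b, f.π b = 0 → α b = b := by
  constructor
  · intro h b hb
    obtain ⟨w, rfl⟩ := f.exists_of_π_eq_zero b hb
    rw [← ι_restrict_mulVec, h, Matrix.one_mulVec]
  · intro h
    refine f.matrix_eq_of_ι fun w => ?_
    rw [ι_restrict_mulVec, Matrix.one_mulVec, h _ (f.π_ι w)]

/-- The first factor of the image of `ι` is `pB`, which every endomorphism preserves. -/
theorem restrict_toBlocks₂₁ (α : AddMonoid.End B) : (f.restrict α).toBlocks₂₁ = 0 := by
  refine Matrix.ext_iff_mulVec.2 fun v => ?_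
  obtain ⟨b, rfl⟩ := f.π_surjective v
  have h : (f.restrict α).mulVec (Sum.elim (f.π b) 0) = Sum.elim (f.π (α b)) 0 := by
    apply f.ι_injective
    rw [ι_restrict_mulVec, ← f.nsmul_eq, ← f.nsmul_eq, map_nsmul]
  rw [← Matrix.fromBlocks_toBlocks (f.restrict α), Matrix.fromBlocks_mulVec] at h
  ext i
  have := congrFun h (Sum.inr i)
  simpa using this

theorem restrict_eq_fromBlocks (α : AddMonoid.End B) :
    f.restrict α = Matrix.fromBlocks (f.restrict α).toBlocks₁₁ (f.restrict α).toBlocks₁₂ 0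
      (f.restrict α).toBlocks₂₂ := by
  conv_lhs => rw [← Matrix.fromBlocks_toBlocks (f.restrict α), restrict_toBlocks₂₁]

theorem restrict_mul_blocks (α β : AddMonoid.End B) :
    (f.restrict (α * β)).toBlocks₁₁ = (f.restrict α).toBlocks₁₁ * (f.restrict β).toBlocks₁₁ ∧
    (f.restrict (α * β)).toBlocks₁₂ = (f.restrict α).toBlocks₁₁ * (f.restrict β).toBlocks₁₂ +
      (f.restrict α).toBlocks₁₂ * (f.restrict β).toBlocks₂₂ ∧
    (f.restrict (α * β)).toBlocks₂₂ = (f.restrict α).toBlocks₂₂ * (f.restrict β).toBlocks₂₂ := by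
  have h := f.restrict.map_mul α β
  rw [f.restrict_eq_fromBlocks α, f.restrict_eq_fromBlocks β, Matrix.fromBlocks_multiply] at h
  rw [h]
  simp

/-- The contragredient of the action on the first factor of the image of `ι`. -/
noncomputable def dualFirst : (AddMonoid.End B)ˣ →* GL (Fin n) (ZMod p) :=
  MonoidHom.toHomUnits
    { toFun := fun α => ((f.restrict (α⁻¹).val).toBlocks₁₁).transpose
      map_one' := by
        rw [inv_one, Units.val_one, map_one, ← Matrix.fromBlocks_one, Matrix.toBlocks_fromBlocks₁₁,
          Matrix.transpose_one]
      map_mul' := fun α β => by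
        rw [mul_inv_rev, Units.val_mul, (f.restrict_mul_blocks _ _).1, Matrix.transpose_mul] }

/-- The contragredient of the action on the quotient of the image of `ι` by its first factor. -/
noncomputable def dualSecond : (AddMonoid.End B)ˣ →* GL (Fin m) (ZMod p) :=
  MonoidHom.toHomUnits
    { toFun := fun α => ((f.restrict (α⁻¹).val).toBlocks₂₂).transpose
      map_one' := by
        rw [inv_one, Units.val_one, map_one, ← Matrix.fromBlocks_one, Matrix.toBlocks_fromBlocks₂₂,
          Matrix.transpose_one]
      map_mul' := fun α β => by
        rw [mul_inv_rev, Units.val_mul, (f.restrict_mul_blocks _ _).2.2, Matrix.transpose_mul] }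

theorem dualFirst_val (α : (AddMonoid.End B)ˣ) :
    (f.dualFirst α).val = ((f.restrict (α⁻¹).val).toBlocks₁₁).transpose := rfl

theorem dualSecond_val (α : (AddMonoid.End B)ˣ) :
    (f.dualSecond α).val = ((f.restrict (α⁻¹).val).toBlocks₂₂).transpose := rfl

/-- The contragredient of the action of the automorphisms of `B` on the image of `ι`. -/
noncomputable def toMatrixSemidirect :
    (AddMonoid.End B)ˣ →* MatrixSemidirect m n (ZMod p) where
  -- The transposed matrix of `α⁻¹` is lower triangular with rows `(A, 0)` and `(Y, M)`. Factoring
  -- it as a unipotent matrix times `diag(A, M)` gives the unipotent entry `Q = Y A⁻¹`.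
  toFun α := ⟨Multiplicative.ofAdd (((f.restrict (α⁻¹).val).toBlocks₁₂).transpose *
    (f.dualFirst α⁻¹).val), (f.dualFirst α, f.dualSecond α)⟩
  map_one' := by
    refine SemidirectProduct.ext ?_ (by rw [map_one, map_one]; rfl)
    rw [inv_one, Units.val_one, map_one, ← Matrix.fromBlocks_one, Matrix.toBlocks_fromBlocks₁₂,
      Matrix.transpose_zero, Matrix.zero_mul]
    rfl
  map_mul' α β := by
    refine SemidirectProduct.ext ?_ (by rw [map_mul, map_mul]; rfl)
    have h1 : (f.dualFirst β).val * (f.dualFirst β⁻¹).val = 1 := by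
      rw [map_inv]
      exact Units.mul_inv _
    apply Multiplicative.toAdd.injective
    show ((f.restrict ((α * β)⁻¹).val).toBlocks₁₂).transpose * (f.dualFirst (α * β)⁻¹).val =
      ((f.restrict (α⁻¹).val).toBlocks₁₂).transpose * (f.dualFirst α⁻¹).val +
      (f.dualSecond α).val * (((f.restrict (β⁻¹).val).toBlocks₁₂).transpose *
        (f.dualFirst β⁻¹).val) * ((f.dualFirst α)⁻¹).val
    rw [mul_inv_rev, Units.val_mul, (f.restrict_mul_blocks _ _).2.1, Matrix.transpose_add,
      Matrix.transpose_mul, Matrix.transpose_mul, ← dualFirst_val, ← dualSecond_val, map_mul,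
      ← map_inv, Units.val_mul, Matrix.add_mul]
    simp only [Matrix.mul_assoc]
    rw [← Matrix.mul_assoc (f.dualFirst β).val, h1, Matrix.one_mul]

theorem toMatrixSemidirect_eq_one_iff (α : (AddMonoid.End B)ˣ) :
    f.toMatrixSemidirect α = 1 ↔ ∀ b, f.π b = 0 → α.val b = b := by
  rw [← restrict_eq_one_iff]
  have hinv : f.restrict α.val = 1 ↔ f.restrict (α⁻¹).val = 1 := by
    have h1 : f.restrict α.val * f.restrict (α⁻¹).val = 1 := by
      rw [← map_mul, Units.mul_inv, map_one]
    constructor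
    · intro h
      rwa [h, one_mul] at h1
    · intro h
      rwa [h, mul_one] at h1
  rw [hinv]
  constructor
  · intro h
    have hA : f.dualFirst α = 1 := congrArg (fun x => x.right.1) h
    have hM : f.dualSecond α = 1 := congrArg (fun x => x.right.2) h
    have hX : ((f.restrict (α⁻¹).val).toBlocks₁₂).transpose * (f.dualFirst α⁻¹).val = 0 :=
      congrArg (fun x => Multiplicative.toAdd x.left) h
    rw [map_inv, hA, inv_one, Units.val_one, Matrix.mul_one, Matrix.transpose_eq_zero] at hX
    rw [Units.ext_iff, dualFirst_val, Units.val_one, Matrix.transpose_eq_one] at hA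
    rw [Units.ext_iff, dualSecond_val, Units.val_one, Matrix.transpose_eq_one] at hM
    rw [restrict_eq_fromBlocks, hA, hX, hM, Matrix.fromBlocks_one]
  · intro h
    have hA : f.dualFirst α = 1 := by
      rw [Units.ext_iff, dualFirst_val, h, ← Matrix.fromBlocks_one, Matrix.toBlocks_fromBlocks₁₁,
        Matrix.transpose_one, Units.val_one]
    have hM : f.dualSecond α = 1 := by
      rw [Units.ext_iff, dualSecond_val, h, ← Matrix.fromBlocks_one, Matrix.toBlocks_fromBlocks₂₂,
        Matrix.transpose_one, Units.val_one]
    refine SemidirectProduct.ext ?_ (Prod.ext hA hM)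
    show Multiplicative.ofAdd (((f.restrict (α⁻¹).val).toBlocks₁₂).transpose *
      (f.dualFirst α⁻¹).val) = 1
    rw [h, ← Matrix.fromBlocks_one, Matrix.toBlocks_fromBlocks₁₂, Matrix.transpose_zero,
      Matrix.zero_mul]
    rfl

theorem toMatrixSemidirect_surjective [Finite B] :
    Function.Surjective f.toMatrixSemidirect := by
  rintro ⟨Q, A, M⟩
  obtain ⟨β, hβ⟩ := f.exists_lift A.val.transpose (Multiplicative.toAdd Q * A.val).transpose
    M.val.transpose
  have hunit : IsUnit (Matrix.fromBlocks A.val.transpose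
      (Multiplicative.toAdd Q * A.val).transpose 0 M.val.transpose) := by
    rw [Matrix.isUnit_iff_isUnit_det, Matrix.det_fromBlocks_zero₂₁, Matrix.det_transpose,
      Matrix.det_transpose]
    exact ((Matrix.isUnit_iff_isUnit_det _).1 A.isUnit).mul
      ((Matrix.isUnit_iff_isUnit_det _).1 M.isUnit)
  obtain ⟨u, hu⟩ := f.exists_unit_of_injective β fun b hb h => by
    obtain ⟨w, rfl⟩ := f.exists_of_π_eq_zero b hb
    rw [hβ, map_eq_zero_iff f.ι f.ι_injective] at h
    rw [Matrix.mulVec_injective_of_isUnit hunit (h.trans (Matrix.mulVec_zero _).symm), map_zero]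
  have hr : f.restrict u.val = Matrix.fromBlocks A.val.transpose
      (Multiplicative.toAdd Q * A.val).transpose 0 M.val.transpose := by
    refine f.matrix_eq_of_ι fun w => ?_
    rw [ι_restrict_mulVec, ← hβ, hu]
    rfl
  have hA : f.dualFirst u⁻¹ = A := by
    rw [Units.ext_iff, dualFirst_val, inv_inv, hr, Matrix.toBlocks_fromBlocks₁₁,
      Matrix.transpose_transpose]
  have hM : f.dualSecond u⁻¹ = M := by
    rw [Units.ext_iff, dualSecond_val, inv_inv, hr, Matrix.toBlocks_fromBlocks₂₂,
      Matrix.transpose_transpose]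
  refine ⟨u⁻¹, SemidirectProduct.ext ?_ (Prod.ext hA hM)⟩
  apply Multiplicative.toAdd.injective
  show ((f.restrict (u⁻¹⁻¹).val).toBlocks₁₂).transpose * (f.dualFirst u⁻¹⁻¹).val =
    Multiplicative.toAdd Q
  rw [map_inv f.dualFirst u⁻¹, hA, inv_inv, hr, Matrix.toBlocks_fromBlocks₁₂,
    Matrix.transpose_transpose, Matrix.mul_assoc, Units.mul_inv, Matrix.mul_one]

end PowerFrame

/-! ### The decomposition of `T(B)` -/

namespace PowerFrame

variable {p n m : ℕ} {B : Type*} [AddCommGroup B] [Group B] {f : PowerFrame p n m B}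
  (hH : ∀ g : Equiv.Perm B, g ∈ Hol B ↔ f.IsLowAffine g)

/-- The image in `T(B)` of the permutations `b ↦ b + quad s b`. -/
def quadHom : Multiplicative (Sym2 (Fin n) → Fin n ⊕ Fin m → ZMod p) →* MultHolQuot B :=
  (QuotientGroup.mk' _).comp
    { toFun := fun s => ⟨f.quadPerm (Multiplicative.toAdd s), quadPerm_mem_NHol hH _⟩
      map_one' := by
        ext b
        simp [quadPerm_apply, zero_quad]
      map_mul' := fun s s' => Subtype.ext (f.quadPerm_add _ _) }

/-- The image in `T(B)` of the automorphisms of the additive group. -/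
def autHom : (AddMonoid.End B)ˣ →* MultHolQuot B :=
  (QuotientGroup.mk' _).comp ((autPerm B).codRestrict (NHol B) (autPerm_mem_NHol hH))

theorem quadHom_mul_autHom_eq_one (hp : Odd p) {s} {α : (AddMonoid.End B)ˣ}
    (h : quadHom hH s * autHom hH α = 1) : s = 1 ∧ ∀ b, f.π b = 0 → α.val b = b := by
  refine quadPerm_mul_autPerm_mem_Hol hH (f := f) hp (s := Multiplicative.toAdd s) ?_
  exact Subgroup.mem_subgroupOf.1 ((QuotientGroup.eq_one_iff _).1 h)

theorem autHom_eq_one_iff (hp : Odd p) (α : (AddMonoid.End B)ˣ) :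
    autHom hH α = 1 ↔ ∀ b, f.π b = 0 → α.val b = b := by
  constructor
  · intro h
    exact (quadHom_mul_autHom_eq_one hH hp (s := 1) (by rw [map_one, one_mul, h])).2
  · intro h
    exact (QuotientGroup.eq_one_iff _).2 (Subgroup.mem_subgroupOf.2 (autPerm_mem_Hol hH h))

theorem exists_quadHom_mul_autHom [Finite B] (hp : Odd p) (t : MultHolQuot B) :
    ∃ s α, quadHom hH s * autHom hH α = t := by
  induction t using QuotientGroup.induction_on with
  | H θ =>
    obtain ⟨α, s, t, h⟩ := exists_of_mem_NHol hH hp θ.2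
    refine ⟨Multiplicative.ofAdd s, α, ?_⟩
    have ht : (QuotientGroup.mk ⟨Equiv.addRight t, addRight_mem_NHol hH t⟩ : MultHolQuot B) = 1 :=
      (QuotientGroup.eq_one_iff _).2 (Subgroup.mem_subgroupOf.2
        ((hH _).2 (IsLowAffine.of_add_right f t)))
    rw [← one_mul (_ * _), ← ht]
    exact congrArg QuotientGroup.mk (Subtype.ext h.symm)

theorem exists_autHom_conj (α : (AddMonoid.End B)ˣ) (s) :
    ∃ s', autHom hH α * quadHom hH s * (autHom hH α)⁻¹ = quadHom hH s' := by
  obtain ⟨s', hs'⟩ := f.exists_quad_comp (Multiplicative.toAdd s) α.val (α⁻¹).val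
  refine ⟨Multiplicative.ofAdd s', ?_⟩
  rw [mul_inv_eq_iff_eq_mul]
  refine congrArg QuotientGroup.mk (Subtype.ext (Equiv.ext fun b => ?_))
  show α.val (b + f.quad (Multiplicative.toAdd s) b) = α.val b + f.quad s' (α.val b)
  rw [hs', end_inv_apply_self, map_add]

theorem quadHom_range_normal [Finite B] (hp : Odd p) : (quadHom hH).range.Normal := by
  constructor
  rintro _ ⟨s, rfl⟩ t
  obtain ⟨s', α, rfl⟩ := exists_quadHom_mul_autHom hH hp t
  obtain ⟨s'', h⟩ := exists_autHom_conj hH α s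
  refine ⟨s' * s'' * s'⁻¹, ?_⟩
  rw [map_mul, map_mul, map_inv, ← h]
  group

theorem quadHom_injective (hp : Odd p) : Function.Injective (quadHom hH) := by
  refine (injective_iff_map_eq_one _).2 fun s h => ?_
  exact (quadHom_mul_autHom_eq_one hH hp (α := 1) (by rw [map_one, mul_one, h])).1

theorem isElementaryAbelian_quadHom_range : IsElementaryAbelian p (quadHom hH).range := by
  constructor
  · rintro ⟨_, s, rfl⟩ ⟨_, s', rfl⟩
    ext1
    show quadHom hH s * quadHom hH s' = quadHom hH s' * quadHom hH s
    rw [← map_mul, mul_comm, map_mul]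
  · rintro ⟨_, s, rfl⟩
    ext1
    show quadHom hH s ^ p = 1
    have : s ^ p = 1 := by
      apply Multiplicative.toAdd.injective
      ext z i
      simp
    rw [← map_pow, this, map_one]

theorem card_quadHom_range [Fact p.Prime] (hp : Odd p) :
    Nat.card (quadHom hH).range = p ^ ((n + m) * (n + 1).choose 2) := by
  rw [← Nat.card_congr (MonoidHom.ofInjective (quadHom_injective hH hp)).toEquiv,
    Nat.card_congr Multiplicative.toAdd, Nat.card_fun, Nat.card_fun]
  simp [Sym2.card, pow_mul]

theorem isComplement'_ranges [Finite B] (hp : Odd p) :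
    Subgroup.IsComplement' (quadHom hH).range (autHom hH).range := by
  refine Subgroup.isComplement'_of_disjoint_and_mul_eq_univ ?_ ?_
  · rw [Subgroup.disjoint_def]
    rintro _ ⟨s, rfl⟩ ⟨α, h⟩
    have := quadHom_mul_autHom_eq_one hH hp (s := s) (α := α⁻¹)
      (by rw [map_inv, h, mul_inv_cancel])
    rw [this.1, map_one]
  · refine Set.eq_univ_of_forall fun t => ?_
    obtain ⟨s, α, rfl⟩ := exists_quadHom_mul_autHom hH hp t
    exact Set.mul_mem_mul ⟨s, rfl⟩ ⟨α, rfl⟩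

/-- Both homomorphisms out of the additive automorphisms have as kernel those trivial on `ker π`, so
their images are isomorphic. -/
theorem nonempty_autHom_range_mulEquiv [Fact p.Prime] [Finite B] (hp : Odd p) :
    Nonempty ((autHom hH).range ≃* MatrixSemidirect m n (ZMod p)) := by
  have hker : (autHom hH).ker = f.toMatrixSemidirect.ker := by
    ext α
    rw [MonoidHom.mem_ker, MonoidHom.mem_ker, autHom_eq_one_iff hH hp,
      toMatrixSemidirect_eq_one_iff]
  exact ⟨(QuotientGroup.quotientKerEquivRange _).symm.trans
    ((QuotientGroup.quotientMulEquivOfEq hker).trans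
      (QuotientGroup.quotientKerEquivOfSurjective _ f.toMatrixSemidirect_surjective))⟩

end PowerFrame

/-! ### Existence of the edge ordering and of the group -/

/-- Every `n ≥ 4` admits an ordering of the pairs `a < b` in `Fin n` that extends `edge n`. -/
theorem exists_isEdgeOrdering {n : ℕ} (hn : 4 ≤ n) :
    n ≤ n.choose 2 ∧ ∃ ε : Fin n ⊕ Fin (n.choose 2 - n) → Fin n × Fin n, IsEdgeOrdering ε := by
  have hcard : Fintype.card {q : Fin n × Fin n // q.1 < q.2} = n.choose 2 := by
    rw [Fintype.card_subtype, ← Finset.univ_product_univ, Finset.card_product_filter_lt,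
      Finset.card_univ, Fintype.card_fin]
  let e : Fin n → {q : Fin n × Fin n // q.1 < q.2} := fun i => ⟨edge n i, edge_lt hn i⟩
  have he : Function.Injective e := fun i j h => edge_injective hn (congrArg Subtype.val h)
  have hle : n ≤ n.choose 2 := by
    have := Fintype.card_le_of_injective e he
    rwa [hcard, Fintype.card_fin] at this
  refine ⟨hle, ?_⟩
  classical
  have hcompl : Fintype.card (Fin (n.choose 2 - n)) = Fintype.card ↥(Set.range e)ᶜ := by
    rw [Fintype.card_compl_set, Set.card_range_of_injective he, hcard, Fintype.card_fin,
      Fintype.card_fin]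
  let g : Fin n ⊕ Fin (n.choose 2 - n) ≃ {q : Fin n × Fin n // q.1 < q.2} :=
    (Equiv.sumCongr (Equiv.ofInjective e he) (Fintype.equivOfCardEq hcompl)).trans
      (Equiv.Set.sumCompl (Set.range e))
  refine ⟨fun s => (g s).val, ⟨Subtype.val_injective.comp g.injective, fun s => (g s).2,
    fun j k hjk => ?_, fun i => ?_⟩⟩
  · exact ⟨g.symm ⟨(j, k), hjk⟩, by rw [g.apply_symm_apply]⟩
  · rfl

namespace PowerFrame

variable {p n m : ℕ} {B : Type*} [AddCommGroup B] (f : PowerFrame p n m B)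

/-- The group with underlying set `B` and product `x + y + ι (π x ∧ π y)`. -/
abbrev wedgeGroup (ε : Fin n ⊕ Fin m → Fin n × Fin n) : Group B :=
  { mul := fun x y => x + y + f.ι (wedge ε (f.π x) (f.π y))
    one := 0
    inv := fun x => -x
    mul_assoc := fun x y z => by
      show x + y + f.ι (wedge ε (f.π x) (f.π y)) + z +
          f.ι (wedge ε (f.π (x + y + f.ι (wedge ε (f.π x) (f.π y)))) (f.π z)) =
        x + (y + z + f.ι (wedge ε (f.π y) (f.π z))) +
          f.ι (wedge ε (f.π x) (f.π (y + z + f.ι (wedge ε (f.π y) (f.π z)))))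
      simp only [map_add, f.π_ι, add_zero, wedge_add_left, wedge_add_right]
      abel
    one_mul := fun x => by
      show 0 + x + f.ι (wedge ε (f.π 0) (f.π x)) = x
      rw [map_zero, wedge_zero_left, map_zero, zero_add, add_zero]
    mul_one := fun x => by
      show x + 0 + f.ι (wedge ε (f.π x) (f.π 0)) = x
      rw [map_zero, wedge_zero_right, map_zero, add_zero, add_zero]
    inv_mul_cancel := fun x => by
      show -x + x + f.ι (wedge ε (f.π (-x)) (f.π x)) = 0
      rw [map_neg, wedge_swap, wedge_neg_right, wedge_self, neg_zero, neg_zero, map_zero, add_zero,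
        neg_add_cancel] }

variable {f}

theorem IsWedgeProduct.isOfClassTwo [Group B] [Fact p.Prime]
    {ε : Fin n ⊕ Fin m → Fin n × Fin n} (h : f.IsWedgeProduct ε) (hp : Odd p)
    (hε : IsEdgeOrdering ε) (hn : 4 ≤ n) : IsOfClassTwo B := by
  have πmul : ∀ x y : B, f.π (x * y) = f.π x + f.π y := fun x y => by
    rw [h, map_add, map_add, f.π_ι, add_zero]
  have htop : Subgroup.upperCentralSeries B 2 = ⊤ := by
    refine (Subgroup.eq_top_iff' _).2 fun x => Subgroup.mem_upperCentralSeries_succ_iff.2 fun y => ?_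
    rw [Subgroup.upperCentralSeries_one, Subgroup.mem_center_iff]
    intro z
    change z * (x * y * x⁻¹ * y⁻¹) = x * y * x⁻¹ * y⁻¹ * z
    have hc : f.π (x * y * x⁻¹ * y⁻¹) = 0 := by
      rw [πmul, πmul, πmul, h.inv_eq_neg, h.inv_eq_neg, map_neg, map_neg]
      abel
    rw [h.mul_eq_add hc, h (x * y * x⁻¹ * y⁻¹), hc, wedge_zero_left, map_zero, add_zero, add_comm]
  have hnil : Group.IsNilpotent B := ⟨2, htop⟩
  refine ⟨hnil, le_antisymm (Subgroup.upperCentralSeries_eq_top_iff_nilpotencyClass_le.1 htop) ?_⟩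
  by_contra! hlt
  have hcenter := Subgroup.upperCentralSeries_eq_top_iff_nilpotencyClass_le.2 (Nat.le_of_lt_succ hlt)
  rw [Subgroup.upperCentralSeries_one] at hcenter
  -- Two elements whose wedge is a single coordinate vector: if they commuted, twice that vector
  -- would vanish.
  let s : Fin n ⊕ Fin m := Sum.inl ⟨0, by omega⟩
  obtain ⟨x, hx⟩ := f.π_surjective (Pi.single (ε s).1 1)
  obtain ⟨y, hy⟩ := f.π_surjective (Pi.single (ε s).2 1)
  have hcomm : x * y = y * x :=
    (Subgroup.mem_center_iff.1 (hcenter ▸ Subgroup.mem_top x) y).symm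
  have h2 := h.mul_eq_mul_swap x y
  rw [hcomm, left_eq_mul, h.one_eq_zero, hx, hy, wedge_single ε hε.injective hε.lt] at h2
  have h3 : f.ι (Pi.single s 1) = 0 :=
    f.eq_of_two_nsmul_eq hp (f.π_ι _) (map_zero _) (by rw [h2, smul_zero])
  rw [map_eq_zero_iff f.ι f.ι_injective] at h3
  simpa using congrFun h3 s

end PowerFrame

/-! ### The concrete frame on `(ℤ/p²)^n × (ℤ/p)^m` -/

/-- The additive group `(ℤ / p²)^n × (ℤ / p)^m`. -/
def PowerCarrier (p n m : ℕ) : Type := (Fin n → ZMod (p ^ 2)) × (Fin m → ZMod p)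

instance (p n m : ℕ) : AddCommGroup (PowerCarrier p n m) :=
  inferInstanceAs (AddCommGroup ((Fin n → ZMod (p ^ 2)) × (Fin m → ZMod p)))

theorem card_powerCarrier (p n m : ℕ) : Nat.card (PowerCarrier p n m) = p ^ (2 * n + m) := by
  show Nat.card ((Fin n → ZMod (p ^ 2)) × (Fin m → ZMod p)) = _
  rw [Nat.card_prod, Nat.card_fun, Nat.card_fun, Nat.card_zmod, Nat.card_zmod, Nat.card_fin,
    Nat.card_fin, ← pow_mul, ← pow_add]

section Carrier

variable (p : ℕ) [Fact p.Prime]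

/-- Reduction modulo `p`. -/
def reduceMod : ZMod (p ^ 2) →+* ZMod p := ZMod.castHom (dvd_pow_self p two_ne_zero) (ZMod p)

/-- Multiplication by `p`, as a map from `ℤ / p` to `ℤ / p²`. -/
def mulMod : ZMod p →+ ZMod (p ^ 2) :=
  ZMod.lift p ⟨zmultiplesHom (ZMod (p ^ 2)) (p : ZMod (p ^ 2)), by
    have : ((p ^ 2 : ℕ) : ZMod (p ^ 2)) = 0 := ZMod.natCast_self _
    simpa [sq] using this⟩

theorem mulMod_natCast (k : ℕ) : mulMod p k = ((p * k : ℕ) : ZMod (p ^ 2)) := by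
  have : mulMod p ((k : ℤ) : ZMod p) = zmultiplesHom (ZMod (p ^ 2)) (p : ZMod (p ^ 2)) k :=
    ZMod.lift_coe _ _ _
  rw [Int.cast_natCast] at this
  rw [this]
  simp [mul_comm]

theorem mulMod_reduceMod (x : ZMod (p ^ 2)) : mulMod p (reduceMod p x) = p • x := by
  obtain ⟨k, rfl⟩ := ZMod.natCast_zmod_surjective x
  rw [map_natCast, mulMod_natCast]
  simp

theorem reduceMod_mulMod (x : ZMod p) : reduceMod p (mulMod p x) = 0 := by
  obtain ⟨k, rfl⟩ := ZMod.natCast_zmod_surjective x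
  rw [mulMod_natCast, map_natCast]
  simp

theorem reduceMod_surjective : Function.Surjective (reduceMod p) := by
  intro x
  obtain ⟨k, rfl⟩ := ZMod.natCast_zmod_surjective x
  exact ⟨k, map_natCast _ _⟩

theorem mul_mulMod (a : ZMod (p ^ 2)) (x : ZMod p) :
    a * mulMod p x = mulMod p (reduceMod p a * x) := by
  obtain ⟨y, rfl⟩ := reduceMod_surjective p x
  rw [← map_mul, mulMod_reduceMod, mulMod_reduceMod, mul_smul_comm]

theorem mulMod_injective : Function.Injective (mulMod p) := by
  refine (injective_iff_map_eq_zero _).2 fun x h => ?_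
  obtain ⟨k, rfl⟩ := ZMod.natCast_zmod_surjective x
  rw [mulMod_natCast, ZMod.natCast_eq_zero_iff, sq] at h
  rw [ZMod.natCast_eq_zero_iff]
  exact Nat.dvd_of_mul_dvd_mul_left (Fact.out : p.Prime).pos h

theorem exists_mulMod_eq {x : ZMod (p ^ 2)} (h : reduceMod p x = 0) : ∃ y, mulMod p y = x := by
  obtain ⟨k, rfl⟩ := ZMod.natCast_zmod_surjective x
  rw [map_natCast, ZMod.natCast_eq_zero_iff] at h
  obtain ⟨l, rfl⟩ := h
  exact ⟨l, mulMod_natCast p l⟩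

variable (n m : ℕ)

instance : Finite (PowerCarrier p n m) := by
  have : NeZero (p ^ 2) := ⟨pow_ne_zero 2 (NeZero.ne p)⟩
  exact inferInstanceAs (Finite ((Fin n → ZMod (p ^ 2)) × (Fin m → ZMod p)))

/-- The standard frame of `(ℤ / p²)^n × (ℤ / p)^m`. -/
def PowerCarrier.frame : PowerFrame p n m (PowerCarrier p n m) where
  ι := AddMonoidHom.mk' (fun w => (fun i => mulMod p (w (Sum.inl i)), fun s => w (Sum.inr s)))
    fun u v => Prod.ext (funext fun i => map_add _ _ _) rfl
  π := AddMonoidHom.mk' (fun b i => reduceMod p (b.1 i)) fun x y => funext fun i => map_add _ _ _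
  ι_injective u v h := by
    ext (i | i)
    · exact mulMod_injective p (congrFun (congrArg Prod.fst h) i)
    · exact congrFun (congrArg Prod.snd h) i
  π_surjective v := by
    choose u hu using fun i => reduceMod_surjective p (v i)
    exact ⟨(u, 0), funext hu⟩
  π_ι w := funext fun i => reduceMod_mulMod p _
  exists_of_π_eq_zero b hb := by
    choose u hu using fun i => exists_mulMod_eq p (congrFun hb i)
    exact ⟨Sum.elim u b.2, Prod.ext (funext hu) rfl⟩
  nsmul_eq b := by
    refine Prod.ext (funext fun i => (mulMod_reduceMod p (b.1 i)).symm) (funext fun s => ?_)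
    show p • b.2 s = 0
    simp
  exists_lift A X M := by
    -- Entries of `A` are lifted to `ℤ/p²`; the choice is immaterial on multiples of `p`. The block
    -- `X` acts through `mulMod`, the embedding of `ℤ/p` into `ℤ/p²`.
    choose a ha using fun i k => reduceMod_surjective p (A i k)
    refine ⟨AddMonoidHom.mk' (fun b => ((Matrix.of a).mulVec b.1 + mulMod p ∘ X.mulVec b.2,
      M.mulVec b.2)) fun x y => Prod.ext ?_ (Matrix.mulVec_add M x.2 y.2), fun w => ?_⟩
    · show (Matrix.of a).mulVec (x.1 + y.1) + mulMod p ∘ X.mulVec (x.2 + y.2) =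
        (Matrix.of a).mulVec x.1 + mulMod p ∘ X.mulVec x.2 +
          ((Matrix.of a).mulVec y.1 + mulMod p ∘ X.mulVec y.2)
      rw [Matrix.mulVec_add, Matrix.mulVec_add]
      ext i
      simp only [Pi.add_apply, Function.comp_apply, map_add]
      abel
    · rw [Matrix.fromBlocks_mulVec]
      refine Prod.ext (funext fun i => ?_) (funext fun i => ?_)
      · show (∑ k, a i k * mulMod p (w (Sum.inl k))) + mulMod p (X.mulVec (w ∘ Sum.inr) i) =
          mulMod p ((A.mulVec (w ∘ Sum.inl) + X.mulVec (w ∘ Sum.inr)) i)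
        rw [Pi.add_apply, map_add]
        congr 1
        show _ = mulMod p (∑ k, A i k * w (Sum.inl k))
        rw [map_sum]
        refine Finset.sum_congr rfl fun k _ => ?_
        rw [mul_mulMod, ha]
      · show M.mulVec (w ∘ Sum.inr) i =
          ((0 : Matrix (Fin m) (Fin n) (ZMod p)).mulVec (w ∘ Sum.inl) + M.mulVec (w ∘ Sum.inr)) i
        rw [Matrix.zero_mulVec, zero_add]

end Carrier

theorem theorem1p1 (p : ℕ) [Fact p.Prime] (hp : Odd p) (n : ℕ) (hn : 4 ≤ n) :
    ∃ (G : Type) (_ : Group G),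
      Finite G ∧ IsPGroup p G ∧ IsOfClassTwo G ∧ Nat.card G = p ^ (n + n.choose 2) ∧
      ∃ E K : Subgroup (MultHolQuot G),
        E.Normal ∧ IsElementaryAbelian p E ∧
        Nat.card E = p ^ (n.choose 2 * (n + 1).choose 2) ∧
        Subgroup.IsComplement' E K ∧
        Nonempty (K ≃* MatrixSemidirect (n.choose 2 - n) n (ZMod p)) := by
  obtain ⟨hle, ε, hε⟩ := exists_isEdgeOrdering hn
  let f := PowerCarrier.frame p n (n.choose 2 - n)
  let : Group (PowerCarrier p n (n.choose 2 - n)) := f.wedgeGroup ε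
  have hmul : f.IsWedgeProduct ε := fun _ _ => rfl
  have hH := hmul.mem_Hol_iff hp hn hε
  have hcard : Nat.card (PowerCarrier p n (n.choose 2 - n)) = p ^ (n + n.choose 2) := by
    rw [card_powerCarrier]
    congr 1
    omega
  refine ⟨PowerCarrier p n (n.choose 2 - n), inferInstance, inferInstance, IsPGroup.of_card hcard,
    hmul.isOfClassTwo hp hε hn, hcard, (PowerFrame.quadHom hH).range,
    (PowerFrame.autHom hH).range, PowerFrame.quadHom_range_normal hH hp,
    PowerFrame.isElementaryAbelian_quadHom_range hH, ?_, PowerFrame.isComplement'_ranges hH hp,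
    PowerFrame.nonempty_autHom_range_mulEquiv hH hp⟩
  rw [PowerFrame.card_quadHom_range hH hp, Nat.add_sub_cancel' hle]
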